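/- Conventions. All generalized quadrangles are thick. A translation generalized quadrangle (TGQ) $(\mathcal S,x,A)$ is a generalized quadrangle $\mathcal S$ with a point $x$ and an abelian automorphism group $A$ of $\mathcal S$ that fixes every line incident with $x$ and acts sharply transitively on the affine points, i.e. the points not collinear with $x$. Its kernel $\mathrm{end}^{\mathrm t}(A,A)$ is the ring of all endomorphisms $\xi$ of $A$ with $A_U^{\xi}\le A_U$ for every line $U$ incident with an affine point $z$, where $A_U$ is the stabilizer of $U$ in $A$ (this does not depend on $z$). The TGQ is linear if its kernel is a division ring. A TGQ $(\overline{\mathcal S},\overline x,\overline A)$ ideally contains $(\mathcal S,x,A)$ if $\mathcal S$ is (up to isomorphism) a subquadrangle of $\overline{\mathcal S}$ such that every line of $\overline{\mathcal S}$ incident with a point of $\mathcal S$ is a line of $\mathcal S$, $x=\overline x$, and every element of $A$ is induced by an element of $\overline A$. A projective representation of a TGQ $(\Gamma,x,C)$ over its kernel $K$, supposed to be a division ring, is the following. Regard $C$ as a $K$-vector space, let $\mathbb P$ be the projective space of $K\oplus C$ and let $\mathbb P'$ be its hyperplane of vectors with first coordinate $0$. The affine points of $\Gamma$ are identified with the points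 of $\mathbb P\setminus\mathbb P'$ in such a way that $C$ acts as the group of translations of $\mathbb P$ with axis $\mathbb P'$. For every line $M$ of $\Gamma$ not incident with $x$, and for every point $m\neq x$ collinear with $x$, the affine points on $M$, respectively those collinear with $m$, are exactly the points outside $\mathbb P'$ of a subspace $\mathbb P_M$, respectively $\mathbb P_m$, of $\mathbb P$. Moreover, for each line $L$ incident with $x$, the subspace $\mathbb P_M\cap\mathbb P'$ is the same for all lines $M$ not incident with $x$ that are concurrent with $L$, and $\mathbb P_m\cap\mathbb P'$ is the same for all points $m\ne x$ on $L$. Theorem (Weak projective representation of TGQs). Every translation generalized quadrangle $(\mathcal S,x,A)$ that is not of order $(2,2)$ is ideally contained in a linear translation generalized quadrangle $(\overline{\mathcal S},\overline x,\overline A)$, and the latter has a projective representation over its kernel; thus $(\mathcal S,x,A)$ is weakly represented in a projective space over a division ring. -/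

import Mathlib

universe u v

/-! Generalized quadrangles, translation generalized quadrangles, their kernels, ideal containment
and projective representations.  A point-line geometry with point set `P` and line set `B` is
given by its incidence relation `I : P → B → Prop`. -/

namespace Quadrangle

/-- A (thick) generalized quadrangle: two distinct points are on at most one common line; for a
point `p` not on a line `L` there is a unique incident pair `(q, M)` with `p` on `M` and `q` on `L`;
every line has at least three points and every point is on at least three lines. -/
structure IsGQ {P : Type*} {B : Type*} (I : P → B → Prop) : Prop where
  nonempty : Nonempty P
  eq_or_eq : ∀ (p q : P) (L M : B), I p L → I q L → I p M → I q M → p = q ∨ L = M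
  proj : ∀ (p : P) (L : B), ¬ I p L → ∃! f : P × B, I p f.2 ∧ I f.1 f.2 ∧ I f.1 L
  thick_line : ∀ L : B, 2 < {p : P | I p L}.encard
  thick_point : ∀ p : P, 2 < {L : B | I p L}.encard

/-- The group of all automorphisms of a geometry: pairs of a permutation of the points and a
permutation of the lines that together preserve incidence. -/
def automorphismGroup {P : Type*} {B : Type*} (I : P → B → Prop) :
    Subgroup (Equiv.Perm P × Equiv.Perm B) where
  carrier := {g | ∀ p L, I (g.1 p) (g.2 L) ↔ I p L}
  mul_mem' := by
    intro g h hg hh p L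
    exact (hg (h.1 p) (h.2 L)).trans (hh p L)
  one_mem' := fun _ _ => Iff.rfl
  inv_mem' := by
    intro g hg p L
    have h := hg (g.1⁻¹ p) (g.2⁻¹ L)
    rw [show g.1 (g.1⁻¹ p) = p from g.1.apply_symm_apply p,
      show g.2 (g.2⁻¹ L) = L from g.2.apply_symm_apply L] at h
    exact h.symm

/-- Two points are collinear if some line contains both.  In a generalized quadrangle every point
is collinear with itself. -/
def Collinear {P : Type*} {B : Type*} (I : P → B → Prop) (p q : P) : Prop :=
  ∃ L, I p L ∧ I q L

end Quadrangle

open Quadrangle in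
/-- A translation generalized quadrangle `(Γ, x, A)`: a generalized quadrangle with an abelian group
`A` of automorphisms that fixes every line incident with the point `x` and acts sharply
transitively on the points not collinear with `x`. -/
structure TGQ (P : Type*) (B : Type*) where
  /-- incidence -/
  I : P → B → Prop
  isGQ : IsGQ I
  /-- the translation point -/
  x : P
  /-- the translation group -/
  A : Subgroup (Equiv.Perm P × Equiv.Perm B)
  le_aut : A ≤ automorphismGroup I
  comm : ∀ a ∈ A, ∀ b ∈ A, a * b = b * a
  fixes : ∀ a ∈ A, ∀ L, I x L → a.2 L = L
  sharp : ∀ p q, ¬ Collinear I x p → ¬ Collinear I x q → ∃! a, a ∈ A ∧ a.1 p = q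

namespace TGQ

open Quadrangle

variable {P : Type*} {B : Type*}

/-- The affine points: those not collinear with the translation point. -/
def IsAffine (T : TGQ P B) (p : P) : Prop := ¬ Collinear T.I T.x p

/-- The quadrangle has order `(s, t)` for natural numbers `s` and `t`: every line has `s + 1` points
and every point is on `t + 1` lines. -/
def HasOrder (T : TGQ P B) (s t : ℕ) : Prop :=
  (∀ L, {p : P | T.I p L}.encard = s + 1) ∧ (∀ p, {L : B | T.I p L}.encard = t + 1)

instance instCommGroupA (T : TGQ P B) : CommGroup T.A :=
  { (inferInstance : Group T.A) with
    mul_comm := fun a b => Subtype.ext (T.comm a.1 a.2 b.1 b.2) }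

/-- The stabilizer `A_U` of a line `U` in the translation group, in additive notation. -/
def lineStab (T : TGQ P B) (U : B) : AddSubgroup (Additive T.A) where
  carrier := {a | a.toMul.1.2 U = U}
  add_mem' := by
    intro a b ha hb
    change a.toMul.1.2 (b.toMul.1.2 U) = U
    rw [show b.toMul.1.2 U = U from hb]
    exact ha
  zero_mem' := rfl
  neg_mem' := by
    intro a ha
    change a.toMul.1.2⁻¹ U = U
    rw [Equiv.Perm.inv_eq_iff_eq]
    exact (show a.toMul.1.2 U = U from ha).symm

/-- The kernel `end^t(A, A)`, as a subring of the endomorphism ring of `A`: the endomorphisms of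
`A` that map the stabilizer `A_U` into itself for every line `U` on an affine point. -/
def kernel (T : TGQ P B) : Subring (AddMonoid.End (Additive T.A)) where
  carrier := {ξ | ∀ z, T.IsAffine z → ∀ U, T.I z U → ∀ a ∈ T.lineStab U, ξ a ∈ T.lineStab U}
  mul_mem' := fun hξ hη z hz U hU a ha => hξ z hz U hU _ (hη z hz U hU a ha)
  one_mem' := fun _ _ _ _ _ ha => ha
  add_mem' := fun hξ hη z hz U hU a ha =>
    (T.lineStab U).add_mem (hξ z hz U hU a ha) (hη z hz U hU a ha)
  zero_mem' := fun _ _ U _ _ _ => (T.lineStab U).zero_mem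
  neg_mem' := fun hξ z hz U hU a ha => (T.lineStab U).neg_mem (hξ z hz U hU a ha)

/-- For the kernel it is enough to look at the lines on one affine point `z`, which may be chosen
at will. -/
theorem mem_kernel_iff (T : TGQ P B) {z : P} (hz : T.IsAffine z)
    (ξ : AddMonoid.End (Additive T.A)) :
    ξ ∈ T.kernel ↔ ∀ U, T.I z U → ∀ a ∈ T.lineStab U, ξ a ∈ T.lineStab U := by
  refine ⟨fun h => h z hz, fun h w hw U hU a ha => ?_⟩
  obtain ⟨g, ⟨hgA, hg⟩, -⟩ := T.sharp z w hz hw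
  have hU' : g.2 (g.2⁻¹ U) = U := g.2.apply_symm_apply U
  have key : ∀ b : Additive T.A, b ∈ T.lineStab U ↔ b ∈ T.lineStab (g.2⁻¹ U) := by
    intro b
    have hc := congrArg (fun f => f.2 (g.2⁻¹ U)) (T.comm g hgA b.toMul.1 b.toMul.2)
    simp only [Prod.snd_mul, Equiv.Perm.mul_apply, hU'] at hc
    change b.toMul.1.2 U = U ↔ b.toMul.1.2 (g.2⁻¹ U) = g.2⁻¹ U
    rw [← hc]
    constructor
    · intro e
      rw [Equiv.Perm.eq_inv_iff_eq]
      exact e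
    · intro e
      rw [e, hU']
  rw [key]
  refine h _ ?_ a ((key a).1 ha)
  have h2 := T.le_aut hgA z (g.2⁻¹ U)
  rw [hU', hg] at h2
  exact h2.1 hU

/-- A TGQ is linear if its kernel is a division ring. -/
def IsLinear (T : TGQ P B) : Prop :=
  Nontrivial T.kernel ∧ ∀ ξ : T.kernel, ξ ≠ 0 → IsUnit ξ

/-- `T` is ideally contained in `T'`: `T` is identified, through injective maps of points and of
lines, with a subquadrangle of `T'` (with the induced incidence), such that every line of `T'` on a
point of `T` is a line of `T`; the translation point of `T` is that of `T'`, and every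
translation of `T` is induced by a translation of `T'`. -/
def IdeallyContainedIn {P' : Type*} {B' : Type*} (T : TGQ P B) (T' : TGQ P' B') : Prop :=
  ∃ (φ : P → P') (ψ : B → B'), Function.Injective φ ∧ Function.Injective ψ ∧
    (∀ p L, T'.I (φ p) (ψ L) ↔ T.I p L) ∧
    (∀ p U, T'.I (φ p) U → ∃ L, ψ L = U) ∧
    φ T.x = T'.x ∧
    ∀ a ∈ T.A, ∃ a' ∈ T'.A, (∀ p, φ (a.1 p) = a'.1 (φ p)) ∧ ∀ L, ψ (a.2 L) = a'.2 (ψ L)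

/-- The hyperplane at infinity of the projective space of `K × V`: the vectors with first coordinate
zero. -/
def infinity (K : Type*) (V : Type*) [DivisionRing K] [AddCommGroup V] [Module K V] :
    Submodule K (K × V) :=
  LinearMap.ker (LinearMap.fst K K V)

/-- The linear map `(c, w) ↦ (c, w + c • v)`, which induces the translation along `v` of the
projective space of `K × V` with axis the hyperplane at infinity. -/
def translationMap (K : Type*) {V : Type*} [DivisionRing K] [AddCommGroup V] [Module K V] (v : V) :
    (K × V) →ₗ[K] (K × V) :=
  LinearMap.prod (LinearMap.fst K K V)
    (LinearMap.snd K K V + (LinearMap.fst K K V).smulRight v)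

theorem translationMap_injective (K : Type*) {V : Type*} [DivisionRing K] [AddCommGroup V]
    [Module K V] (v : V) : Function.Injective (translationMap K v) := by
  rintro ⟨c, w⟩ ⟨c', w'⟩ h
  have h1 : c = c' := congrArg Prod.fst h
  have h2 : w + c • v = w' + c' • v := congrArg Prod.snd h
  rw [h1] at h2
  rw [h1, add_right_cancel h2]

/-- A projective (Bruck-Bose) representation of a TGQ `(Γ, x, A)` over a division ring `K`
in the projective space of `K × V`.  Subspaces of the projective space are written as linear
subspaces of `K × V`. -/
structure ProjectiveRepresentation (T : TGQ P B) (K : Type*) (V : Type*) [DivisionRing K]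
    [AddCommGroup V] [Module K V] where
  /-- `K` is the kernel -/
  scalar : K ≃+* T.kernel
  /-- `A` is the group of translations with axis the hyperplane at infinity -/
  translation : Additive T.A ≃+ V
  /-- the vector space structure is the one of `A` over the kernel -/
  translation_scalar : ∀ (k : K) (a : Additive T.A),
    translation ((scalar k : AddMonoid.End (Additive T.A)) a) = k • translation a
  /-- the affine points of the quadrangle are the points off the hyperplane at infinity -/
  point : P → Projectivization K (K × V)
  point_bij : Set.BijOn point {p | T.IsAffine p} {Q | ¬ Q.submodule ≤ infinity K V}
  point_translation : ∀ (a : Additive T.A) (p : P), T.IsAffine p →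
    point (a.toMul.1.1 p) = Projectivization.map (translationMap K (translation a))
      (translationMap_injective K (translation a)) (point p)
  /-- the subspaces that represent the lines -/
  line : B → Submodule K (K × V)
  /-- a line not on `x` consists, as far as affine points go, of the affine points of its subspace -/
  mem_line : ∀ L, ¬ T.I T.x L → ∀ p, T.IsAffine p → (T.I p L ↔ (point p).submodule ≤ line L)
  /-- a line `L` on `x` is represented by the subspace in which the hyperplane at infinity meets the
  subspace of any line `M` that is concurrent with `L` and not on `x` (an element of the egg) -/
  egg : ∀ L M, T.I T.x L → ¬ T.I T.x M → (∃ m, T.I m L ∧ T.I m M) →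
    line M ⊓ infinity K V = line L
  /-- the subspaces that represent the points collinear with `x` and different from `x` -/
  pointSpace : P → Submodule K (K × V)
  /-- the affine points collinear with such a point `m` are the affine points of its subspace -/
  mem_pointSpace : ∀ m, m ≠ T.x → Collinear T.I T.x m → ∀ p, T.IsAffine p →
    (Collinear T.I m p ↔ (point p).submodule ≤ pointSpace m)
  /-- the subspaces of two such points on the same line on `x` have the same part at infinity (the
  tangent space of the egg element of that line) -/
  tangent : ∀ L m m', T.I T.x L → T.I m L → T.I m' L → m ≠ T.x → m' ≠ T.x →
    pointSpace m ⊓ infinity K V = pointSpace m' ⊓ infinity K V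

end TGQ

/-!
The translation group `A` of a translation generalized quadrangle, with the stabilizers `S i` of the
lines on one affine point and the stabilizers `R i` of the points where these lines meet the lines
on the translation point, is a *Kantor family* (`IsKantorFamily`), and the quadrangle is recovered
from it by a coset geometry (`KantorGeometry.toTGQ`). Kernel elements are the endomorphisms of `A`
that stabilize all `S i`.

If there are at least four indices, a nonzero kernel element is injective, stabilizes all `R i`, and
reflects membership in `S i` and `R i` (`eq_zero_or_injective`, `map_mem_tangent`, `mem_of_map_mem`,
`mem_tangent_of_map_mem`). With only three indices the quadrangle has order `(2, 2)`
(`hasOrder_two_two`), which is the excluded case. So a nonzero kernel element `ξ` embeds the Kantor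
family into itself, and after renaming `ξ(A)` as `A` this is an extension of the family with the
same index set. Hence a Kantor family without proper extensions has a division ring as kernel.

Such extensions cannot grow indefinitely: `S j` embeds into the index set (`exists_injective`, the
inequality `s ≤ t`), so the size of the group is bounded in terms of the index set
(`exists_injective_total`). The integers lie in the kernel, so `A` is torsion-free or of prime
exponent and embeds into a vector space over a prime field, which may be taken of dimension larger
than that bound. Inside it, Zorn's lemma gives a maximal extension; it is a subspace, and there is
enough room to realize there the extension given by a kernel element `ξ`, which therefore is
surjective (`exists_linear_extension`). No Ore condition on the kernel of the original quadrangle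
is needed, and that kernel need not act on the extension.

An extension of Kantor families with the same index set yields an ideal containment of quadrangles
(`ideallyContainedIn`; the lines on a point at infinity are dealt with by `exists_sub_mem`), and the
cosets of the `S i` and `R i`, which are subspaces over the kernel, give the projective
representation (`nonempty_projectiveRepresentation`).
-/

universe w

open Quadrangle

/-! ### Kantor families -/

/-- Members `S i` and tangent groups `R i` of a Kantor family of the subgroup `E` of an ambient
abelian group. These are the properties of the stabilizers of the lines `U i` on an affine point `z`
and of the points `m i` on `U i` collinear with the translation point; no finiteness is assumed.
The ambient group makes it possible to compare families of different groups. -/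
structure IsKantorFamily {G I : Type*} [AddCommGroup G] (E : AddSubgroup G)
    (S R : I → AddSubgroup G) : Prop where
  le : ∀ i, S i ≤ R i
  le_total : ∀ i, R i ≤ E
  exists_three : ∃ i j k : I, i ≠ j ∧ i ≠ k ∧ j ≠ k
  exists_ne_zero : ∀ i, ∃ a ∈ S i, a ≠ 0
  /-- There is no triangle of affine points. -/
  triangle : ∀ i j k, i ≠ j → i ≠ k → j ≠ k → ∀ a ∈ S i, ∀ b ∈ S j, ∀ c ∈ S k, a + b = c → a = 0
  /-- There is no triangle with one vertex at infinity. -/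
  disjoint : ∀ i j, i ≠ j → ∀ a ∈ R i, a ∈ S j → a = 0
  /-- An affine point not collinear with `m i` is collinear with an affine point of `U i`. -/
  split : ∀ i, ∀ c ∈ E, c ∉ R i → ∃ j, j ≠ i ∧ ∃ a ∈ S i, ∃ b ∈ S j, a + b = c
  /-- A point at infinity on the line `i` is collinear with an affine point of `U j`. -/
  sum : ∀ i j, i ≠ j → ∀ c ∈ E, ∃ b ∈ S j, c - b ∈ R i

namespace IsKantorFamily

section Relative

variable {G I : Type*} [AddCommGroup G] {E : AddSubgroup G} {S R : I → AddSubgroup G}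

theorem le_total' (h : IsKantorFamily E S R) (i : I) : S i ≤ E :=
  (h.le i).trans (h.le_total i)

theorem disjoint' (h : IsKantorFamily E S R) {i j : I} (hij : i ≠ j) {a : G} (ha : a ∈ S i)
    (ha' : a ∈ S j) : a = 0 :=
  h.disjoint i j hij a (h.le i ha) ha'

theorem triangle' (h : IsKantorFamily E S R) {i j k : I} (hij : i ≠ j) (hik : i ≠ k)
    (hjk : j ≠ k) {a b c : G} (ha : a ∈ S i) (hb : b ∈ S j) (hc : c ∈ S k) (e : a + b = c) :
    a = 0 ∧ b = 0 ∧ c = 0 := by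
  have h1 := h.triangle i j k hij hik hjk a ha b hb c hc e
  have h2 := h.triangle j i k hij.symm hjk hik b hb a ha c hc (by rw [add_comm]; exact e)
  refine ⟨h1, h2, ?_⟩
  rw [← e, h1, h2, add_zero]

theorem exists_ne (h : IsKantorFamily E S R) (i : I) : ∃ j, j ≠ i := by
  obtain ⟨p, q, -, hpq, -, -⟩ := h.exists_three
  by_cases hp : p = i
  · exact ⟨q, fun hq => hpq (hp.trans hq.symm)⟩
  · exact ⟨p, hp⟩

theorem exists_ne_ne (h : IsKantorFamily E S R) (i j : I) : ∃ k, k ≠ i ∧ k ≠ j := by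
  obtain ⟨p, q, r, hpq, hpr, hqr⟩ := h.exists_three
  by_contra! hc
  have hp := hc p
  have hq := hc q
  have hr := hc r
  by_cases p = i <;> by_cases q = i <;> by_cases r = i <;> simp_all

theorem notMem_of_ne_zero (h : IsKantorFamily E S R) {i j : I} (hij : i ≠ j) {a : G}
    (ha : a ∈ S j) (h0 : a ≠ 0) : a ∉ R i :=
  fun hR => h0 (h.disjoint i j hij a hR ha)

/-- The subgroup `R i` is strictly larger than `S i`. -/
theorem exists_notMem (h : IsKantorFamily E S R) (i : I) : ∃ a ∈ R i, a ∉ S i := by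
  obtain ⟨j, hj⟩ := h.exists_ne i
  obtain ⟨k, hki, hkj⟩ := h.exists_ne_ne i j
  obtain ⟨a, ha, ha0⟩ := h.exists_ne_zero j
  obtain ⟨b, hb, hab⟩ := h.sum i k hki.symm a (h.le_total' j ha)
  refine ⟨_, hab, fun hS => ha0 ?_⟩
  exact (h.triangle' hki hkj hj.symm hb hS ha (by abel)).2.2

/-- Up to one fixed translation, every element is a sum of an element of a given `S i` and an
element of some other `S l`. -/
theorem exists_repr (h : IsKantorFamily E S R) {i j : I} (hij : i ≠ j) {d : G} (hd : d ∈ S j)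
    (hd0 : d ≠ 0) {c : G} (hc : c ∈ E) :
    ∃ u : Bool, ∃ l, l ≠ i ∧ ∃ a ∈ S i, ∃ b ∈ S l, c = a + b - cond u d 0 := by
  by_cases hR : c ∈ R i
  · have hcd : c + d ∉ R i := fun hcd =>
      h.notMem_of_ne_zero hij hd hd0 (by simpa using (R i).sub_mem hcd hR)
    obtain ⟨l, hl, a, ha, b, hb, e⟩ := h.split i _ (E.add_mem hc (h.le_total' j hd)) hcd
    exact ⟨true, l, hl, a, ha, b, hb, by simp [e]⟩
  · obtain ⟨l, hl, a, ha, b, hb, e⟩ := h.split i c hc hR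
    exact ⟨false, l, hl, a, ha, b, hb, by simp [e]⟩

/-- Each `S j` embeds into the set of indices different from `j`: with `a ∈ S i` fixed, send `b` to
the index `l` for which `a + b` lies in `S k + S l`, and to `k` when `a + b` lies in `R k`. -/
theorem exists_injective (h : IsKantorFamily E S R) (j : I) :
    ∃ f : S j → {l : I // l ≠ j}, Function.Injective f := by
  obtain ⟨i, hij⟩ := h.exists_ne j
  obtain ⟨k, hki, hkj⟩ := h.exists_ne_ne i j
  obtain ⟨a, ha, ha0⟩ := h.exists_ne_zero i
  have key : ∀ b : S j, ∃ l : {l : I // l ≠ j}, (l = k ∧ a + b ∈ R k) ∨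
      (l.1 ≠ k ∧ ∃ u ∈ S k, ∃ v ∈ S l, u + v = a + b) := by
    intro b
    by_cases hb : a + b ∈ R k
    · exact ⟨⟨k, hkj⟩, Or.inl ⟨rfl, hb⟩⟩
    · obtain ⟨l, hl, u, hu, v, hv, e⟩ := h.split k _
        (E.add_mem (h.le_total' i ha) (h.le_total' j b.2)) hb
      refine ⟨⟨l, fun hlj => ha0 ?_⟩, Or.inr ⟨hl, u, hu, v, hv, e⟩⟩
      subst hlj
      exact (h.triangle' hkj hki hij.symm hu ((S l).sub_mem hv b.2) ha
        (by rw [← add_sub_assoc, e]; abel)).2.2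
  choose f hf using key
  refine ⟨f, fun b b' hbb => ?_⟩
  have h1 := hf b
  have h2 := hf b'
  rw [← hbb] at h2
  apply Subtype.ext
  rw [← sub_eq_zero]
  have hS : (b : G) - b' ∈ S j := (S j).sub_mem b.2 b'.2
  rcases h1 with ⟨h1, h1'⟩ | ⟨h1, u, hu, v, hv, e⟩
  · rcases h2 with ⟨-, h2'⟩ | ⟨h2, -⟩
    · refine h.disjoint k j hkj _ ?_ hS
      have := (R k).sub_mem h1' h2'
      simpa using this
    · exact absurd h1 h2
  · rcases h2 with ⟨h2, -⟩ | ⟨-, u', hu', v', hv', e'⟩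
    · exact absurd h2 h1
    · refine (h.triangle' (Ne.symm h1) hkj (f b).2 ((S k).sub_mem hu hu')
        ((S _).sub_mem hv hv') hS ?_).2.2
      rw [show u - u' + (v - v') = (u + v) - (u' + v') by abel, e, e']
      abel

/-- A crude bound on the size of the group of a Kantor family in terms of the index set alone. -/
theorem exists_injective_total (h : IsKantorFamily E S R) :
    ∃ f : E → Bool × I × I × I, Function.Injective f := by
  obtain ⟨i, j, -, hij, -, -⟩ := h.exists_three
  obtain ⟨d, hd, hd0⟩ := h.exists_ne_zero j
  choose f hf using h.exists_injective
  have key := fun c : E => h.exists_repr hij hd hd0 c.2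
  choose u l hl a ha b hb e using key
  refine ⟨fun c => (u c, l c, f i ⟨a c, ha c⟩, f (l c) ⟨b c, hb c⟩), fun c c' hcc => ?_⟩
  simp only [Prod.mk.injEq] at hcc
  obtain ⟨h1, h2, h3, h4⟩ := hcc
  have h3' := congrArg Subtype.val (hf i (Subtype.ext h3))
  have h4' : b c = b c' := by
    have aux : ∀ m (hm : m = l c) (hb' : b c' ∈ S m),
        (f m ⟨b c', hb'⟩ : I) = f (l c) ⟨b c, hb c⟩ → b c = b c' := by
      rintro m rfl hb' e'
      exact (congrArg Subtype.val (hf _ (Subtype.ext e'))).symm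
    exact aux _ h2.symm (hb c') h4.symm
  apply Subtype.ext
  rw [e c, e c', h1, h4', show a c = a c' from h3']

/-- A Kantor family in a subgroup `E` is a Kantor family of the group `E`. -/
theorem toSubtype (h : IsKantorFamily E S R) :
    IsKantorFamily (⊤ : AddSubgroup E) (fun i => (S i).addSubgroupOf E)
      (fun i => (R i).addSubgroupOf E) where
  le i a ha := h.le i ha
  le_total i := le_top
  exists_three := h.exists_three
  exists_ne_zero i := by
    obtain ⟨a, ha, h0⟩ := h.exists_ne_zero i
    exact ⟨⟨a, h.le_total' i ha⟩, ha, fun e => h0 (congrArg Subtype.val e)⟩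
  triangle i j k hij hik hjk a ha b hb c hc e :=
    Subtype.ext (h.triangle i j k hij hik hjk a ha b hb c hc (congrArg Subtype.val e))
  disjoint i j hij a ha ha' := Subtype.ext (h.disjoint i j hij a ha ha')
  split i c _ hc := by
    obtain ⟨j, hj, a, ha, b, hb, e⟩ := h.split i c c.2 hc
    exact ⟨j, hj, ⟨a, h.le_total' i ha⟩, ha, ⟨b, h.le_total' j hb⟩, hb, Subtype.ext e⟩
  sum i j hij c _ := by
    obtain ⟨b, hb, hc⟩ := h.sum i j hij c c.2
    exact ⟨⟨b, h.le_total' j hb⟩, hb, hc⟩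

/-- The image of a Kantor family under an injective homomorphism. -/
theorem map {H : Type*} [AddCommGroup H] (h : IsKantorFamily E S R) (f : G →+ H)
    (hf : Function.Injective f) :
    IsKantorFamily (E.map f) (fun i => (S i).map f) (fun i => (R i).map f) where
  le i := AddSubgroup.map_mono (h.le i)
  le_total i := AddSubgroup.map_mono (h.le_total i)
  exists_three := h.exists_three
  exists_ne_zero i := by
    obtain ⟨a, ha, h0⟩ := h.exists_ne_zero i
    exact ⟨f a, ⟨a, ha, rfl⟩, (map_ne_zero_iff f hf).2 h0⟩
  triangle := by
    rintro i j k hij hik hjk _ ⟨a, ha, rfl⟩ _ ⟨b, hb, rfl⟩ _ ⟨c, hc, rfl⟩ e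
    rw [← map_add] at e
    rw [h.triangle i j k hij hik hjk a ha b hb c hc (hf e), map_zero]
  disjoint := by
    rintro i j hij _ ⟨a, ha, rfl⟩ ⟨b, hb, e⟩
    obtain rfl := hf e
    rw [h.disjoint i j hij _ ha hb, map_zero]
  split := by
    rintro i _ ⟨c, hc, rfl⟩ hR
    obtain ⟨j, hj, a, ha, b, hb, rfl⟩ := h.split i c hc (fun hc' => hR ⟨c, hc', rfl⟩)
    exact ⟨j, hj, _, ⟨a, ha, rfl⟩, _, ⟨b, hb, rfl⟩, (map_add f a b).symm⟩
  sum := by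
    rintro i j hij _ ⟨c, hc, rfl⟩
    obtain ⟨b, hb, hR⟩ := h.sum i j hij c hc
    exact ⟨_, ⟨b, hb, rfl⟩, _, hR, map_sub f c b⟩

end Relative

/-! ### Endomorphisms stabilizing all members of a Kantor family -/

section Endomorphism

variable {G I : Type*} [AddCommGroup G] {S R : I → AddSubgroup G} {ξ : G →+ G}

/-- Expand `a + b` along `S k` and some `S l` and apply `ξ`: as `ξ a = 0`, a triangle arises unless
`ξ b = 0`. -/
theorem map_eq_zero_of_add_notMem (h : IsKantorFamily ⊤ S R) (hξ : ∀ i, ∀ a ∈ S i, ξ a ∈ S i)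
    {i j k : I} (hij : i ≠ j) (hik : i ≠ k) (hjk : j ≠ k) {a b : G} (ha : a ∈ S i) (ha0 : a ≠ 0)
    (hξa : ξ a = 0) (hb : b ∈ S j) (hR : a + b ∉ R k) : ξ b = 0 := by
  obtain ⟨l, hl, c, hc, d, hd, e⟩ := h.split k (a + b) trivial hR
  have hlj : l ≠ j := by
    rintro rfl
    exact ha0 (h.triangle' hjk.symm hik.symm hij.symm hc ((S l).sub_mem hd hb) ha
      (by rw [← add_sub_assoc, e]; abel)).2.2
  refine (h.triangle' hl.symm hjk.symm hlj (hξ k c hc) (hξ l d hd) (hξ j b hb) ?_).2.2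
  rw [← map_add, e, map_add, hξa, zero_add]

/-- If the member `S j` has order two, then so have all members. -/
theorem eq_of_mem_of_forall (h : IsKantorFamily ⊤ S R) {j : I} {b : G}
    (hS : ∀ x ∈ S j, x = 0 ∨ x = b) (n : I) {x y : G} (hx : x ∈ S n) (hy : y ∈ S n) (hx0 : x ≠ 0)
    (hy0 : y ≠ 0) : x = y := by
  obtain ⟨m, hmn, hmj⟩ := h.exists_ne_ne n j
  obtain ⟨u, hu, hxu⟩ := h.sum m j hmj x trivial
  obtain ⟨v, hv, hyv⟩ := h.sum m j hmj y trivial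
  have hu' : u = b := (hS u hu).resolve_left fun h0 =>
    h.notMem_of_ne_zero hmn hx hx0 (by simpa [h0] using hxu)
  have hv' : v = b := (hS v hv).resolve_left fun h0 =>
    h.notMem_of_ne_zero hmn hy hy0 (by simpa [h0] using hyv)
  have := (R m).sub_mem hxu hyv
  rw [hu', hv', sub_sub_sub_cancel_right] at this
  exact sub_eq_zero.1 (h.disjoint m n hmn _ this ((S n).sub_mem hx hy))

/-- If all members have order two and there are at least four of them, then an endomorphism cannot
vanish on one member and not on another: the sum of the nonzero elements of four members is the
nonzero element of a fifth one. -/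
theorem map_eq_zero_of_order_two (h : IsKantorFamily ⊤ S R)
    (hξ : ∀ i, ∀ a ∈ S i, ξ a ∈ S i) {i j k l : I} (hij : i ≠ j) (hik : i ≠ k) (hil : i ≠ l)
    (hjk : j ≠ k) (hjl : j ≠ l) (hkl : k ≠ l) {a b : G} (ha : a ∈ S i) (ha0 : a ≠ 0)
    (hξa : ξ a = 0) (hb : b ∈ S j) (hS : ∀ x ∈ S j, x = 0 ∨ x = b) (hR : a + b ∈ R l) :
    ξ b = 0 := by
  by_contra hb0
  have hξb : ξ b = b := (hS _ (hξ j b hb)).resolve_left hb0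
  have hb0' : b ≠ 0 := fun e => hb0 (by rw [e, map_zero])
  have hfix : ∀ n, ∀ x ∈ S n, ξ x = 0 ∨ ξ x = x := fun n x hx => by
    by_cases hx0 : x = 0
    · left; rw [hx0, map_zero]
    by_cases hx1 : ξ x = 0
    · exact Or.inl hx1
    · exact Or.inr (h.eq_of_mem_of_forall hS n (hξ n x hx) hx hx1 hx0)
  obtain ⟨c, hc, hc0⟩ := h.exists_ne_zero k
  have hR' : a + b + c ∉ R l := fun hmem =>
    h.notMem_of_ne_zero hkl.symm hc hc0 (by simpa using (R l).sub_mem hmem hR)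
  obtain ⟨m, hm, d, hd, f, hf, e⟩ := h.split l _ trivial hR'
  have hf0 : f ≠ 0 := by
    rintro rfl
    -- then `d = a + b + c` lies in `S l`, against `a + b ∈ R l` and `c ∉ R l`
    exact hR' (by rw [← e, add_zero]; exact h.le l hd)
  have hmi : m ≠ i := by
    rintro rfl
    have : f = a := h.eq_of_mem_of_forall hS m hf ha hf0 ha0
    subst this
    exact hb0' (h.triangle' hjk hjl hkl hb hc hd
      (by rw [eq_sub_of_add_eq e]; abel)).1
  have hmj : m ≠ j := by
    rintro rfl
    have : f = b := h.eq_of_mem_of_forall hS m hf hb hf0 hb0'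
    subst this
    exact ha0 (h.triangle' hik hil hkl ha hc hd (by rw [eq_sub_of_add_eq e]; abel)).1
  have hmk : m ≠ k := by
    rintro rfl
    have : f = c := h.eq_of_mem_of_forall hS m hf hc hf0 hc0
    subst this
    exact ha0 (h.triangle' hij hil hjl ha hb hd (by rw [eq_sub_of_add_eq e]; abel)).1
  have e' := congrArg ξ e
  simp only [map_add, hξa, hξb, zero_add] at e'
  rcases hfix k c hc with h1 | h1 <;> rcases hfix l d hd with h2 | h2 <;>
    rcases hfix m f hf with h3 | h3 <;> rw [h1, h2, h3] at e' <;>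
    (try simp only [add_zero, zero_add] at e')
  · exact hb0' e'.symm
  · subst e'
    exact hb0' (h.disjoint' hmj.symm hb hf)
  · subst e'
    exact hb0' (h.disjoint' hjl hb hd)
  · exact hb0' (h.triangle' hm.symm hjl.symm hmj hd hf hb e').2.2
  · refine hb0' (h.disjoint' hjk hb ?_)
    rw [eq_neg_of_add_eq_zero_left e'.symm]
    exact (S k).neg_mem hc
  · exact hb0' (h.triangle' hjk hmj.symm hmk.symm hb hc hf e'.symm).1
  · exact hb0' (h.triangle' hjk hjl hkl hb hc hd e'.symm).1
  · exact ha0 (by rw [e', add_assoc] at e; exact right_eq_add.1 e)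

/-- An endomorphism stabilizing all members that kills one nonzero element of some member kills
every member. -/
theorem map_eq_zero_of_mem (h : IsKantorFamily ⊤ S R)
    (h4 : ∀ i j : I, ∃ k l, i ≠ k ∧ i ≠ l ∧ j ≠ k ∧ j ≠ l ∧ k ≠ l)
    (hξ : ∀ i, ∀ a ∈ S i, ξ a ∈ S i) {i j : I} {a b : G} (ha : a ∈ S i) (ha0 : a ≠ 0)
    (hξa : ξ a = 0) (hb : b ∈ S j) : ξ b = 0 := by
  have main : ∀ i j : I, i ≠ j → ∀ a ∈ S i, a ≠ 0 → ξ a = 0 → ∀ b ∈ S j, ξ b = 0 := by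
    intro i j hij a ha ha0 hξa b hb
    by_contra hb0
    have hmem : ∀ k, i ≠ k → j ≠ k → ∀ x ∈ S j, ξ x ≠ 0 → a + x ∈ R k :=
      fun k hik hjk x hx hx0 => by
        by_contra hR
        exact hx0 (h.map_eq_zero_of_add_notMem hξ hij hik hjk ha ha0 hξa hx hR)
    obtain ⟨k, l, hik, hil, hjk, hjl, hkl⟩ := h4 i j
    -- all elements of `S j` outside the kernel of `ξ` coincide modulo `R k`
    have huniq : ∀ x ∈ S j, ξ x ≠ 0 → x = b := fun x hx hx0 => by
      have := (R k).sub_mem (hmem k hik hjk x hx hx0) (hmem k hik hjk b hb hb0)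
      rw [add_sub_add_left_eq_sub] at this
      exact sub_eq_zero.1 (h.disjoint k j hjk.symm _ this ((S j).sub_mem hx hb))
    have hS : ∀ x ∈ S j, x = 0 ∨ x = b := fun x hx => by
      by_cases hx0 : ξ x = 0
      · left
        have := huniq (x + b) ((S j).add_mem hx hb) (by rw [map_add, hx0, zero_add]; exact hb0)
        simpa using this
      · exact Or.inr (huniq x hx hx0)
    exact hb0 (h.map_eq_zero_of_order_two hξ hij hik hil hjk hjl hkl ha ha0 hξa hb hS
      (hmem l hil hjl b hb hb0))
  by_cases hij : i = j
  · subst hij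
    obtain ⟨k, hk⟩ := h.exists_ne i
    obtain ⟨c, hc, hc0⟩ := h.exists_ne_zero k
    exact main k i hk c hc hc0 (main i k hk.symm a ha ha0 hξa c hc) b hb
  · exact main i j hij a ha ha0 hξa b hb

/-- The kernel of a Kantor family with at least four members has no zero divisors, since its nonzero
elements are injective. -/
theorem eq_zero_or_injective (h : IsKantorFamily ⊤ S R)
    (h4 : ∀ i j : I, ∃ k l, i ≠ k ∧ i ≠ l ∧ j ≠ k ∧ j ≠ l ∧ k ≠ l)
    (hξ : ∀ i, ∀ a ∈ S i, ξ a ∈ S i) : ξ = 0 ∨ Function.Injective ξ := by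
  obtain ⟨i, j, -, hij, -, -⟩ := h.exists_three
  obtain ⟨d, hd, hd0⟩ := h.exists_ne_zero j
  by_cases h0 : ∃ i, ∃ a ∈ S i, a ≠ 0 ∧ ξ a = 0
  · left
    obtain ⟨n, x, hx, hx0, hξx⟩ := h0
    have hz : ∀ m, ∀ y ∈ S m, ξ y = 0 := fun m y hy =>
      h.map_eq_zero_of_mem h4 hξ hx hx0 hξx hy
    ext c
    obtain ⟨u, l, -, a, ha, b, hb, rfl⟩ := h.exists_repr hij hd hd0 (c := c) trivial
    cases u <;> simp [hz i a ha, hz l b hb, hz j d hd]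
  · right
    push Not at h0
    rw [injective_iff_map_eq_zero]
    intro c hc
    obtain ⟨u, l, hl, a, ha, b, hb, rfl⟩ := h.exists_repr hij hd hd0 (c := c) trivial
    have hinj : ∀ m, ∀ y ∈ S m, ξ y = 0 → y = 0 := fun m y hy hy0 => by
      by_contra hne
      exact h0 m y hy hne hy0
    have two : ∀ y ∈ S l, ξ a + ξ y = 0 → a + y = 0 := fun y hy hay => by
      have h1 : ξ a = 0 := by
        refine h.disjoint' hl.symm (hξ i a ha) ?_
        rw [eq_neg_of_add_eq_zero_left hay]
        exact (S l).neg_mem (hξ l y hy)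
      rw [h1, zero_add] at hay
      rw [hinj i a ha h1, hinj l y hy hay, zero_add]
    cases u
    · simpa using two b hb (by simpa using hc)
    · by_cases hlj : l = j
      · subst hlj
        have := two (b - d) ((S l).sub_mem hb hd) (by
          rw [← map_add, ← add_sub_assoc]; simpa using hc)
        simpa [add_sub_assoc] using this
      · have := h.triangle' hl.symm hij hlj (hξ i a ha) (hξ l b hb) (hξ j d hd)
          (sub_eq_zero.1 (by simpa using hc))
        exact absurd (hinj j d hd this.2.2) hd0

/-- An injective endomorphism stabilizing the members also stabilizes the tangent groups. -/
theorem map_mem_tangent (h : IsKantorFamily ⊤ S R) (hξ : ∀ i, ∀ a ∈ S i, ξ a ∈ S i)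
    (hinj : Function.Injective ξ) {i : I} {c : G} (hc : c ∈ R i) : ξ c ∈ R i := by
  by_contra hR
  obtain ⟨j, hj, a, ha, b, hb, e⟩ := h.split i (ξ c) trivial hR
  obtain ⟨d, hd, hd0⟩ := h.exists_ne_zero j
  have hcd : c + d ∉ R i := fun hcd =>
    h.notMem_of_ne_zero hj.symm hd hd0 (by simpa using (R i).sub_mem hcd hc)
  obtain ⟨l, hl, u, hu, v, hv, e'⟩ := h.split i (c + d) trivial hcd
  by_cases hlj : l = j
  · subst hlj
    have hvd : v - d ∈ R i := by
      rw [show v - d = c - u by rw [sub_eq_sub_iff_add_eq_add, add_comm v u, e']]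
      exact (R i).sub_mem hc (h.le i hu)
    have := h.disjoint i l hl.symm _ hvd ((S l).sub_mem hv hd)
    have hcu : c = u := by
      rw [sub_eq_zero.1 this] at e'
      exact (add_right_cancel e').symm
    exact hR (h.le i (hξ i c (hcu ▸ hu)))
  · have e2 : ξ u + ξ v = a + b + ξ d := by rw [e, ← map_add, ← map_add, e']
    have := h.triangle' hl.symm hj.symm hlj ((S i).sub_mem (hξ i u hu) ha) (hξ l v hv)
      ((S j).add_mem hb (hξ j d hd)) (by
        rw [sub_add_eq_add_sub, e2]; abel)
    have hv0 : v = 0 := hinj (by rw [this.2.1, map_zero])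
    rw [hv0, add_zero] at e'
    exact hcd (e' ▸ h.le i hu)

theorem mem_tangent_of_map_mem (h : IsKantorFamily ⊤ S R) (hξ : ∀ i, ∀ a ∈ S i, ξ a ∈ S i)
    (hinj : Function.Injective ξ) {i : I} {c : G} (hc : ξ c ∈ R i) : c ∈ R i := by
  by_contra hR
  obtain ⟨j, hj, a, ha, b, hb, rfl⟩ := h.split i c trivial hR
  rw [map_add] at hc
  have hb' := h.disjoint i j hj.symm _
    (by simpa using (R i).sub_mem hc (h.le i (hξ i a ha))) (hξ j b hb)
  have hb0 : b = 0 := hinj (by rw [hb', map_zero])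
  rw [hb0, add_zero] at hR
  exact hR (h.le i ha)

theorem mem_of_map_mem (h : IsKantorFamily ⊤ S R) (hξ : ∀ i, ∀ a ∈ S i, ξ a ∈ S i)
    (hinj : Function.Injective ξ) {i : I} {c : G} (hc : ξ c ∈ S i) : c ∈ S i := by
  obtain ⟨j, hj⟩ := h.exists_ne i
  by_cases hR : c ∈ R j
  · have h0 := h.disjoint j i hj _ (h.map_mem_tangent hξ hinj hR) hc
    rw [hinj (h0.trans (map_zero ξ).symm)]
    exact (S i).zero_mem
  · obtain ⟨l, hl, a, ha, b, hb, rfl⟩ := h.split j c trivial hR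
    rw [map_add] at hc
    by_cases hli : l = i
    · subst hli
      have h0 : ξ a = 0 := h.disjoint' hj (hξ j a ha) (by
        simpa using (S l).sub_mem hc (hξ l b hb))
      rw [hinj (h0.trans (map_zero ξ).symm), zero_add]
      exact hb
    · have := h.triangle' hl.symm hj hli (hξ j a ha) (hξ l b hb) hc rfl
      rw [hinj (this.1.trans (map_zero ξ).symm), hinj (this.2.1.trans (map_zero ξ).symm), add_zero]
      exact (S i).zero_mem

end Endomorphism
end IsKantorFamily

/-! ### Extensions of Kantor families and their kernels -/

/-- A prime field: every element is a quotient of two integers. -/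
def IsPrimeField (F : Type*) [Field F] : Prop :=
  ∀ f : F, ∃ n m : ℤ, (n : F) ≠ 0 ∧ f * n = m

/-- A subspace of an infinite-dimensional space whose dimension is smaller than that of the whole
space: any injective endomorphism of the subspace becomes the inclusion after re-embedding the
subspace into the whole space. -/
theorem Submodule.exists_injective_comp_eq_subtype {F : Type u} {Ω : Type v} [Field F]
    [AddCommGroup Ω] [Module F Ω] (W : Submodule F Ω) (hΩ : Cardinal.aleph0 ≤ Module.rank F Ω)
    (hW : Module.rank F W < Module.rank F Ω) (ξ : W →ₗ[F] W) (hξ : Function.Injective ξ) :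
    ∃ g : W →ₗ[F] Ω, Function.Injective g ∧ ∀ w, g (ξ w) = w := by
  have hlt : Module.rank F W < Module.rank F (Ω ⧸ W) := by
    by_contra! hle
    have := Cardinal.add_lt_of_lt hΩ (hle.trans_lt hW) hW
    rw [W.rank_quotient_add_rank] at this
    exact lt_irrefl _ this
  obtain ⟨j, hj⟩ := Module.Free.exists_linearMap_injective_of_rank_lt hlt
  obtain ⟨s, hs⟩ := LinearMap.exists_rightInverse_of_surjective W.mkQ W.range_mkQ
  obtain ⟨ρ, hρ⟩ := LinearMap.exists_leftInverse_of_injective ξ (LinearMap.ker_eq_bot.2 hξ)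
  have hs' : ∀ q, W.mkQ (s q) = q := fun q => LinearMap.congr_fun hs q
  have hρ' : ∀ w, ρ (ξ w) = w := fun w => LinearMap.congr_fun hρ w
  -- invert `ξ` on its range and embed a complement of the range modulo `W`
  refine ⟨W.subtype ∘ₗ ρ + s ∘ₗ j ∘ₗ (LinearMap.id - ξ ∘ₗ ρ), ?_, fun w => ?_⟩
  · rw [injective_iff_map_eq_zero]
    intro w hw
    have h1 := congrArg W.mkQ hw
    simp only [LinearMap.add_apply, LinearMap.comp_apply, map_add, hs', map_zero,
      Submodule.subtype_apply] at h1
    rw [show W.mkQ (ρ w : Ω) = 0 by simp, zero_add, map_eq_zero_iff _ hj] at h1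
    have h2 : w = ξ (ρ w) := sub_eq_zero.1 h1
    simp only [LinearMap.add_apply, LinearMap.comp_apply, h1, map_zero, add_zero] at hw
    rw [h2, show ρ w = 0 from Subtype.ext hw, map_zero]
  · simp [hρ']

namespace IsKantorFamily

/-- The group of a Kantor family with at least four members is torsion-free or of prime exponent, so
that it embeds into a vector space over a prime field. -/
theorem exists_embedding {G : Type u} {I : Type v} [AddCommGroup G] {S R : I → AddSubgroup G}
    (h : IsKantorFamily ⊤ S R)
    (h4 : ∀ i j : I, ∃ k l, i ≠ k ∧ i ≠ l ∧ j ≠ k ∧ j ≠ l ∧ k ≠ l) :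
    ∃ (F : Type) (_ : Field F) (V : Type u) (_ : AddCommGroup V) (_ : Module F V) (ι : G →+ V),
      IsPrimeField F ∧ Function.Injective ι := by
  obtain ⟨i₀, -, -, -, -, -⟩ := h.exists_three
  obtain ⟨a₀, -, ha₀⟩ := h.exists_ne_zero i₀
  have hor : ∀ n : ℕ, (∀ x : G, n • x = 0) ∨ Function.Injective (fun x : G => n • x) := by
    intro n
    have hn := h.eq_zero_or_injective h4 (ξ := nsmulAddMonoidHom n)
      (fun i a ha => (S i).nsmul_mem ha n)
    exact hn.imp_left fun h0 x => DFunLike.congr_fun h0 x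
  by_cases hp : ∃ p : ℕ, p.Prime ∧ ∀ x : G, p • x = 0
  · obtain ⟨p, hp, hpG⟩ := hp
    have : Fact p.Prime := ⟨hp⟩
    let _ : Module (ZMod p) G := AddCommGroup.zmodModule hpG
    refine ⟨ZMod p, inferInstance, G, inferInstance, inferInstance, AddMonoidHom.id G,
      fun f => ?_, Function.injective_id⟩
    obtain ⟨m, rfl⟩ := ZMod.intCast_surjective f
    exact ⟨1, m, by simp, by simp⟩
  · push Not at hp
    have htf : ∀ n : ℕ, n ≠ 0 → Function.Injective (fun x : G => n • x) := by
      intro n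
      -- a product of primes is injective when each of the primes is
      induction n using Nat.recOnMul with
      | zero => intro h0; exact absurd rfl h0
      | one => intro _ x y hxy; simpa using hxy
      | prime p hp' =>
        intro _
        obtain ⟨x, hx⟩ := hp p hp'
        exact (hor p).resolve_left fun h0 => hx (h0 x)
      | mul a b iha ihb =>
        intro hab
        have := (iha (left_ne_zero_of_mul hab)).comp (ihb (right_ne_zero_of_mul hab))
        intro x y hxy
        exact this (by simpa [mul_smul] using hxy)
    have hz : ∀ n : ℤ, n ≠ 0 → ∀ x : G, n • x = 0 → x = 0 := by
      intro n hn x hx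
      refine htf n.natAbs (Int.natAbs_ne_zero.2 hn) ?_
      simp only [smul_zero]
      rcases Int.natAbs_eq n with e | e <;> rw [e] at hx <;> simpa using hx
    refine ⟨Localization (nonZeroDivisors ℤ),
      inferInstanceAs (Field (FractionRing ℤ)), LocalizedModule (nonZeroDivisors ℤ) G,
      inferInstance, inferInstance,
      (LocalizedModule.mkLinearMap (nonZeroDivisors ℤ) G).toAddMonoidHom, fun f => ?_, ?_⟩
    · obtain ⟨⟨m, n⟩, e⟩ := IsLocalization.surj (nonZeroDivisors ℤ) f
      refine ⟨n, m, ?_, by simpa using e⟩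
      rw [← eq_intCast (algebraMap ℤ (Localization (nonZeroDivisors ℤ)))]
      exact IsLocalization.to_map_ne_zero_of_mem_nonZeroDivisors _ le_rfl n.2
    · rw [injective_iff_map_eq_zero]
      intro x hx
      have hx' : LocalizedModule.mk x (1 : nonZeroDivisors ℤ) = LocalizedModule.mk 0 1 :=
        hx.trans (LocalizedModule.zero_mk 1).symm
      obtain ⟨c, hc⟩ := LocalizedModule.mk_eq.1 hx'
      refine hz c (nonZeroDivisors.ne_zero c.2) x ?_
      rw [one_smul, one_smul, smul_zero] at hc
      exact hc

end IsKantorFamily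

/-- A Kantor family of some subgroup of an ambient group. -/
structure KantorSubfamily (Ω I : Type*) [AddCommGroup Ω] where
  /-- the group of the family -/
  total : AddSubgroup Ω
  /-- the members `S i` -/
  member : I → AddSubgroup Ω
  /-- the tangent groups `R i` -/
  tangent : I → AddSubgroup Ω
  isKantor : IsKantorFamily total member tangent

namespace KantorSubfamily

variable {Ω : Type u} {I : Type v} [AddCommGroup Ω]

/-- The second family extends the first one: it induces the first one on its total group. -/
def Extends (X Y : KantorSubfamily Ω I) : Prop :=
  X.total ≤ Y.total ∧ ∀ a ∈ X.total, ∀ i,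
    (a ∈ Y.member i ↔ a ∈ X.member i) ∧ (a ∈ Y.tangent i ↔ a ∈ X.tangent i)

theorem Extends.refl (X : KantorSubfamily Ω I) : X.Extends X :=
  ⟨le_rfl, fun _ _ _ => ⟨Iff.rfl, Iff.rfl⟩⟩

theorem Extends.trans {X Y Z : KantorSubfamily Ω I} (h : X.Extends Y) (h' : Y.Extends Z) :
    X.Extends Z :=
  ⟨h.1.trans h'.1, fun a ha i => ⟨(h'.2 a (h.1 ha) i).1.trans (h.2 a ha i).1,
    (h'.2 a (h.1 ha) i).2.trans (h.2 a ha i).2⟩⟩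

theorem Extends.member_le {X Y : KantorSubfamily Ω I} (h : X.Extends Y) (i : I) :
    X.member i ≤ Y.member i :=
  fun a ha => (h.2 a (X.isKantor.le_total' i ha) i).1.2 ha

theorem Extends.tangent_le {X Y : KantorSubfamily Ω I} (h : X.Extends Y) (i : I) :
    X.tangent i ≤ Y.tangent i :=
  fun a ha => (h.2 a (X.isKantor.le_total i ha) i).2.2 ha

/-- The union of a nonempty chain of Kantor families is a Kantor family. -/
theorem exists_upperBound (c : Set (KantorSubfamily Ω I)) (hc : IsChain Extends c)
    (hne : c.Nonempty) : ∃ Y : KantorSubfamily Ω I, ∀ X ∈ c, X.Extends Y := by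
  have : Nonempty c := hne.to_subtype
  have hdir : ∀ X Y : c, ∃ Z : c, X.1.Extends Z.1 ∧ Y.1.Extends Z.1 := by
    intro X Y
    rcases eq_or_ne X.1 Y.1 with e | e
    · exact ⟨Y, e ▸ Extends.refl _, Extends.refl _⟩
    · rcases hc X.2 Y.2 e with h | h
      · exact ⟨Y, h, Extends.refl _⟩
      · exact ⟨X, Extends.refl _, h⟩
  have hE : Directed (· ≤ ·) fun X : c => X.1.total := fun X Y =>
    (hdir X Y).imp fun Z hZ => ⟨hZ.1.1, hZ.2.1⟩
  have hS : ∀ i, Directed (· ≤ ·) fun X : c => X.1.member i := fun i X Y =>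
    (hdir X Y).imp fun Z hZ => ⟨hZ.1.member_le i, hZ.2.member_le i⟩
  have hR : ∀ i, Directed (· ≤ ·) fun X : c => X.1.tangent i := fun i X Y =>
    (hdir X Y).imp fun Z hZ => ⟨hZ.1.tangent_le i, hZ.2.tangent_le i⟩
  have mE : ∀ {a}, a ∈ (⨆ X : c, X.1.total) ↔ ∃ X : c, a ∈ X.1.total :=
    AddSubgroup.mem_iSup_of_directed hE
  have mS : ∀ {i a}, a ∈ (⨆ X : c, X.1.member i) ↔ ∃ X : c, a ∈ X.1.member i :=
    fun {i _} => AddSubgroup.mem_iSup_of_directed (hS i)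
  have mR : ∀ {i a}, a ∈ (⨆ X : c, X.1.tangent i) ↔ ∃ X : c, a ∈ X.1.tangent i :=
    fun {i _} => AddSubgroup.mem_iSup_of_directed (hR i)
  refine ⟨⟨⨆ X : c, X.1.total, fun i => ⨆ X : c, X.1.member i, fun i => ⨆ X : c, X.1.tangent i,
    ?_⟩, fun X hX => ⟨fun a ha => mE.2 ⟨⟨X, hX⟩, ha⟩, fun a ha i => ⟨⟨fun h => ?_, fun h => ?_⟩,
      ⟨fun h => ?_, fun h => ?_⟩⟩⟩⟩
  · exact
    { le := fun i => iSup_mono fun X => X.1.isKantor.le i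
      le_total := fun i => iSup_mono fun X => X.1.isKantor.le_total i
      exists_three := hne.some.isKantor.exists_three
      exists_ne_zero := fun i => by
        obtain ⟨X, hX⟩ := hne
        obtain ⟨a, ha, h0⟩ := X.isKantor.exists_ne_zero i
        exact ⟨a, mS.2 ⟨⟨X, hX⟩, ha⟩, h0⟩
      triangle := fun i j k hij hik hjk a ha b hb d hd e => by
        obtain ⟨X₁, h₁⟩ := mS.1 ha
        obtain ⟨X₂, h₂⟩ := mS.1 hb
        obtain ⟨X₃, h₃⟩ := mS.1 hd
        obtain ⟨Y, hY₁, hY₂⟩ := hdir X₁ X₂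
        obtain ⟨Z, hZ₁, hZ₂⟩ := hdir Y X₃
        exact Z.1.isKantor.triangle i j k hij hik hjk a ((hY₁.trans hZ₁).member_le i h₁) b
          ((hY₂.trans hZ₁).member_le j h₂) d (hZ₂.member_le k h₃) e
      disjoint := fun i j hij a ha ha' => by
        obtain ⟨X₁, h₁⟩ := mR.1 ha
        obtain ⟨X₂, h₂⟩ := mS.1 ha'
        obtain ⟨Y, hY₁, hY₂⟩ := hdir X₁ X₂
        exact Y.1.isKantor.disjoint i j hij a (hY₁.tangent_le i h₁) (hY₂.member_le j h₂)
      split := fun i a ha hR => by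
        obtain ⟨X, hX⟩ := mE.1 ha
        obtain ⟨j, hj, x, hx, y, hy, e⟩ :=
          X.1.isKantor.split i a hX fun h => hR (mR.2 ⟨X, h⟩)
        exact ⟨j, hj, x, mS.2 ⟨X, hx⟩, y, mS.2 ⟨X, hy⟩, e⟩
      sum := fun i j hij a ha => by
        obtain ⟨X, hX⟩ := mE.1 ha
        obtain ⟨b, hb, hR⟩ := X.1.isKantor.sum i j hij a hX
        exact ⟨b, mS.2 ⟨X, hb⟩, mR.2 ⟨X, hR⟩⟩ }
  · obtain ⟨Y, hY⟩ := mS.1 h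
    obtain ⟨Z, h₁, h₂⟩ := hdir ⟨X, hX⟩ Y
    exact (h₁.2 a ha i).1.1 (h₂.member_le i hY)
  · exact mS.2 ⟨⟨X, hX⟩, h⟩
  · obtain ⟨Y, hY⟩ := mR.1 h
    obtain ⟨Z, h₁, h₂⟩ := hdir ⟨X, hX⟩ Y
    exact (h₁.2 a ha i).2.1 (h₂.tangent_le i hY)
  · exact mR.2 ⟨⟨X, hX⟩, h⟩

/-- Every Kantor family in an ambient group has a maximal extension there. -/
theorem exists_maximal (X₀ : KantorSubfamily Ω I) :
    ∃ X : KantorSubfamily Ω I, X₀.Extends X ∧ ∀ Y, X.Extends Y → Y.Extends X := by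
  obtain ⟨m, hm⟩ := exists_maximal_of_chains_bounded
    (r := fun X Y : {X : KantorSubfamily Ω I // X₀.Extends X} => X.1.Extends Y.1)
    (fun c hc => by
      rcases c.eq_empty_or_nonempty with rfl | hne
      · exact ⟨⟨X₀, Extends.refl _⟩, by simp⟩
      · obtain ⟨Y, hY⟩ := exists_upperBound (Subtype.val '' c) (by
          rintro _ ⟨X, hX, rfl⟩ _ ⟨Y, hY, rfl⟩ hne
          exact hc hX hY fun e => hne (congrArg _ e)) (hne.image _)
        obtain ⟨X, hX⟩ := hne
        exact ⟨⟨Y, X.2.trans (hY _ ⟨X, hX, rfl⟩)⟩, fun Z hZ => hY _ ⟨Z, hZ, rfl⟩⟩)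
    (fun h h' => h.trans h')
  exact ⟨m.1, m.2, fun Y hY => hm ⟨Y, m.2.trans hY⟩ hY⟩

/-- If the inclusion of a maximal family into the ambient group factors as `g ∘ ξ`, where `ξ` is an
endomorphism in the kernel and `g` is injective, then the image under `g` is an extension of the
family, so `g` maps the family to itself and `ξ` is surjective. -/
theorem map_mem_of_maximal (X : KantorSubfamily Ω I) (hX : ∀ Y, X.Extends Y → Y.Extends X)
    (ξ : X.total →+ X.total)
    (hξ : ∀ i, ∀ a ∈ (X.member i).addSubgroupOf X.total,
      ξ a ∈ (X.member i).addSubgroupOf X.total)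
    (g : X.total →+ Ω) (hg : Function.Injective g) (hgξ : ∀ a, g (ξ a) = a) (a : X.total) :
    g a ∈ X.total := by
  have hK := X.isKantor.toSubtype
  have hinj : Function.Injective ξ := fun a b e =>
    Subtype.ext (by rw [← hgξ a, ← hgξ b, e])
  refine (hX ⟨_, _, _, hK.map g hg⟩ ⟨fun b hb => ⟨ξ ⟨b, hb⟩, trivial, hgξ _⟩,
    fun b hb i => ⟨⟨?_, fun h => ⟨_, hξ i ⟨b, hb⟩ h, hgξ _⟩⟩,
      ⟨?_, fun h => ⟨_, hK.map_mem_tangent hξ hinj (c := ⟨b, hb⟩) h, hgξ _⟩⟩⟩⟩).1 ⟨a, trivial, rfl⟩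
  · rintro ⟨d, hd, e⟩
    have : d = ξ ⟨b, hb⟩ := hg (by rw [e, hgξ])
    subst this
    exact hK.mem_of_map_mem hξ hinj hd
  · rintro ⟨d, hd, e⟩
    have : d = ξ ⟨b, hb⟩ := hg (by rw [e, hgξ])
    subst this
    exact hK.mem_tangent_of_map_mem hξ hinj hd

/-- The total group of a maximal family in a vector space over a prime field is a subspace. -/
theorem smul_mem_of_maximal {F : Type*} [Field F] (hF : IsPrimeField F) [Module F Ω]
    (X : KantorSubfamily Ω I) (hX : ∀ Y, X.Extends Y → Y.Extends X) (f : F) {a : Ω}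
    (ha : a ∈ X.total) : f • a ∈ X.total := by
  obtain ⟨n, m, hn, e⟩ := hF f
  have hf : f • a = (n : F)⁻¹ • (m • a) := by
    rw [← Int.cast_smul_eq_zsmul F m a, smul_smul, ← e]
    congr 1
    field_simp
  rw [hf]
  -- multiplication by `n` lies in the kernel and `n⁻¹` re-embeds the group
  refine X.map_mem_of_maximal hX (zsmulAddGroupHom n)
    (fun i b hb => AddSubgroup.zsmul_mem _ hb n)
    ((DistribSMul.toAddMonoidHom Ω ((n : F)⁻¹)).comp X.total.subtype) ?_ ?_
    ⟨m • a, X.total.zsmul_mem ha m⟩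
  · intro b c hbc
    exact Subtype.ext (smul_right_injective Ω (inv_ne_zero hn) hbc)
  · intro b
    change (n : F)⁻¹ • ((n • b : X.total) : Ω) = b
    rw [AddSubgroup.coe_zsmul, ← Int.cast_smul_eq_zsmul F n, smul_smul, inv_mul_cancel₀ hn,
      one_smul]

/-- In a sufficiently large vector space over a prime field, the nonzero elements of the kernel of
a maximal family are bijective. -/
theorem bijective_of_maximal {F : Type w} [Field F] (hF : IsPrimeField F) [Module F Ω]
    (hΩ : Cardinal.aleph0 ≤ Module.rank F Ω)
    (X : KantorSubfamily Ω I) (hcard : Cardinal.mk X.total < Module.rank F Ω)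
    (hX : ∀ Y, X.Extends Y → Y.Extends X)
    (h4 : ∀ i j : I, ∃ k l, i ≠ k ∧ i ≠ l ∧ j ≠ k ∧ j ≠ l ∧ k ≠ l)
    (ξ : X.total →+ X.total)
    (hξ : ∀ i, ∀ a ∈ (X.member i).addSubgroupOf X.total,
      ξ a ∈ (X.member i).addSubgroupOf X.total) (h0 : ξ ≠ 0) : Function.Bijective ξ := by
  have hinj := (X.isKantor.toSubtype.eq_zero_or_injective h4 hξ).resolve_left h0
  let W : Submodule F Ω :=
    { X.total with smul_mem' := fun f a ha => X.smul_mem_of_maximal hF hX f ha }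
  -- additive maps between vector spaces over a prime field are linear
  let η : W →+ W := ξ
  let ξ' : W →ₗ[F] W :=
    { η with
      map_smul' := fun f a => by
        obtain ⟨n, m, hn, e⟩ := hF f
        have h1 : n • (f • a) = m • a := by
          rw [← Int.cast_smul_eq_zsmul F n, ← Int.cast_smul_eq_zsmul F m, smul_smul, mul_comm, e]
        have h2 : n • η (f • a) = m • η a := by rw [← map_zsmul, h1, map_zsmul]
        refine smul_right_injective W hn ?_
        change (n : F) • η (f • a) = (n : F) • (f • η a)
        rw [Int.cast_smul_eq_zsmul, h2, smul_smul, mul_comm, e, Int.cast_smul_eq_zsmul] }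
  obtain ⟨g, hg, hgξ⟩ := W.exists_injective_comp_eq_subtype hΩ
    ((rank_le_card F W).trans_lt hcard) ξ' hinj
  refine ⟨hinj, fun b => ⟨⟨g b, X.map_mem_of_maximal hX ξ hξ g.toAddMonoidHom hg hgξ b⟩, ?_⟩⟩
  exact hg (hgξ ⟨g b, _⟩)

end KantorSubfamily

/-- Every Kantor family with at least four members is contained in one, with the same index set, all
of whose nonzero kernel elements are bijective. -/
theorem IsKantorFamily.exists_linear_extension {G : Type u} {I : Type v} [AddCommGroup G]
    {S R : I → AddSubgroup G} (h : IsKantorFamily ⊤ S R)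
    (h4 : ∀ i j : I, ∃ k l, i ≠ k ∧ i ≠ l ∧ j ≠ k ∧ j ≠ l ∧ k ≠ l) :
    ∃ (G' : Type (max u v)) (_ : AddCommGroup G') (S' R' : I → AddSubgroup G') (ι : G →+ G'),
      IsKantorFamily ⊤ S' R' ∧ Function.Injective ι ∧ (∀ i a, ι a ∈ S' i ↔ a ∈ S i) ∧
      (∀ i a, ι a ∈ R' i ↔ a ∈ R i) ∧
      ∀ ξ : G' →+ G', (∀ i, ∀ a ∈ S' i, ξ a ∈ S' i) → ξ ≠ 0 → Function.Bijective ξ := by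
  obtain ⟨F, _, V, _, _, ι, hF, hι⟩ := h.exists_embedding h4
  -- a basis index set larger than the bound of `exists_injective_total`
  let J : Type v := Set (ℕ ⊕ (Bool × I × I × I))
  let κ : G →+ V × (J →₀ F) := (AddMonoidHom.inl V (J →₀ F)).comp ι
  have hκ : Function.Injective κ := fun a b e => hι (congrArg Prod.fst e)
  obtain ⟨X, hX, hmax⟩ := KantorSubfamily.exists_maximal ⟨_, _, _, h.map κ hκ⟩
  have hmem : ∀ a, κ a ∈ AddSubgroup.map κ ⊤ := fun a => ⟨a, trivial, rfl⟩
  have hrank : Cardinal.lift.{u} (Cardinal.mk J) ≤ Module.rank F (V × (J →₀ F)) := by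
    rw [rank_prod, rank_finsupp_self, Cardinal.lift_lift]
    refine le_trans ?_ le_add_self
    simp
  have hJ : Cardinal.mk (ℕ ⊕ (Bool × I × I × I)) < Cardinal.mk J := by
    rw [Cardinal.mk_set]
    exact Cardinal.cantor _
  refine ⟨X.total, inferInstance, _, _, κ.codRestrict X.total fun a => hX.1 (hmem a),
    X.isKantor.toSubtype, fun a b e => hκ (congrArg Subtype.val e), fun i a => ?_, fun i a => ?_,
    X.bijective_of_maximal hF ?_ ?_ hmax h4⟩
  · refine ((hX.2 _ (hmem a) i).1).trans ⟨?_, fun ha => ⟨a, ha, rfl⟩⟩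
    rintro ⟨b, hb, e⟩
    exact hκ e ▸ hb
  · refine ((hX.2 _ (hmem a) i).2).trans ⟨?_, fun ha => ⟨a, ha, rfl⟩⟩
    rintro ⟨b, hb, e⟩
    exact hκ e ▸ hb
  · refine le_trans ?_ hrank
    rw [Cardinal.aleph0_le_lift]
    exact (Cardinal.aleph0_le_mk (ℕ ⊕ (Bool × I × I × I))).trans hJ.le
  · refine lt_of_lt_of_le ?_ hrank
    obtain ⟨f, hf⟩ := X.isKantor.exists_injective_total
    have h1 := Cardinal.lift_mk_le_lift_mk_of_injective
      ((Sum.inr_injective (α := ℕ)).comp hf)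
    rw [Cardinal.lift_id'.{v, max u v}, Cardinal.lift_umax.{v, u}] at h1
    exact h1.trans_lt (Cardinal.lift_lt.2 hJ)

/-! ### The generalized quadrangle of a Kantor family -/

theorem Set.two_lt_encard_of_mem {α : Type*} {s : Set α} {a b c : α} (ha : a ∈ s) (hb : b ∈ s)
    (hc : c ∈ s) (hab : a ≠ b) (hac : a ≠ c) (hbc : b ≠ c) : 2 < s.encard := by
  have h3 : ({a, b, c} : Set α).encard = 3 := Set.encard_eq_three.2 ⟨a, b, c, hab, hac, hbc, rfl⟩
  have hle : ({a, b, c} : Set α).encard ≤ s.encard := Set.encard_le_encard (by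
    rintro x (rfl | rfl | rfl) <;> assumption)
  rw [h3] at hle
  exact lt_of_lt_of_le (by norm_num) hle

theorem QuotientAddGroup.mk_eq_mk_iff {G : Type*} [AddCommGroup G] {H : AddSubgroup G} {a b : G} :
    (a : G ⧸ H) = b ↔ b - a ∈ H := by
  rw [QuotientAddGroup.eq, neg_add_eq_sub]

namespace KantorGeometry

variable {G I : Type*} [AddCommGroup G] {S R : I → AddSubgroup G}

/-- The points of the quadrangle of a Kantor family: the translation point, the cosets of the
tangent groups, and the elements of the group, which are the affine points. -/
inductive Point (R : I → AddSubgroup G)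
  | apex : Point R
  | mid (i : I) (q : G ⧸ R i) : Point R
  | aff (a : G) : Point R

/-- The lines of the quadrangle of a Kantor family: the lines on the translation point, and the
cosets of the members. -/
inductive Line (S : I → AddSubgroup G)
  | inf (i : I) : Line S
  | aff (i : I) (q : G ⧸ S i) : Line S

/-- Incidence in the quadrangle of a Kantor family. -/
def Inc : Point R → Line S → Prop
  | .apex, .inf _ => True
  | .apex, .aff _ _ => False
  | .mid i _, .inf j => i = j
  | .mid i q, .aff j r => i = j ∧ ∃ a : G, q = a ∧ r = a
  | .aff _, .inf _ => False
  | .aff a, .aff _ r => r = a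

theorem inc_inf {p : Point R} {i : I} :
    Inc p (.inf i : Line S) ↔ p = .apex ∨ ∃ a : G, p = .mid i a := by
  cases p with
  | apex => simp [Inc]
  | mid j q =>
    obtain ⟨a, rfl⟩ := QuotientAddGroup.mk_surjective q
    simp only [Inc, reduceCtorEq, false_or]
    constructor
    · rintro rfl
      exact ⟨a, rfl⟩
    · rintro ⟨b, e⟩
      injection e
  | aff a => simp [Inc]

theorem inc_line_aff (hSR : ∀ i, S i ≤ R i) {p : Point R} {i : I} {b : G} :
    Inc p (.aff i b : Line S) ↔ p = .mid i b ∨ ∃ c, c - b ∈ S i ∧ p = .aff c := by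
  cases p with
  | apex => simp [Inc]
  | mid j q =>
    simp only [Inc, reduceCtorEq, and_false, exists_false, or_false]
    constructor
    · rintro ⟨rfl, a, rfl, e⟩
      rw [QuotientAddGroup.mk_eq_mk_iff] at e
      congr 1
      rw [eq_comm, QuotientAddGroup.mk_eq_mk_iff]
      exact hSR _ e
    · intro e
      injection e with e1 e2
      subst e1
      exact ⟨rfl, b, eq_of_heq e2, rfl⟩
  | aff a =>
    simp only [Inc, reduceCtorEq, false_or, Point.aff.injEq, QuotientAddGroup.mk_eq_mk_iff]
    constructor
    · intro h
      exact ⟨a, h, rfl⟩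
    · rintro ⟨c, h, rfl⟩
      exact h

theorem apex_inc {M : Line S} : Inc (.apex : Point R) M ↔ ∃ i, M = .inf i := by
  cases M <;> simp [Inc]

theorem mid_inc (hSR : ∀ i, S i ≤ R i) {i : I} {a : G} {M : Line S} :
    Inc (.mid i a : Point R) M ↔ M = .inf i ∨ ∃ b : G, b - a ∈ R i ∧ M = .aff i b := by
  cases M with
  | inf j => simp [Inc, eq_comm]
  | aff j q =>
    obtain ⟨b, rfl⟩ := QuotientAddGroup.mk_surjective q
    rw [inc_line_aff hSR]
    simp only [reduceCtorEq, and_false, exists_false, or_false, false_or]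
    constructor
    · intro e
      injection e with e1 e2
      subst e1
      exact ⟨b, QuotientAddGroup.mk_eq_mk_iff.1 (eq_of_heq e2), rfl⟩
    · rintro ⟨c, hc, e⟩
      injection e with e1 e2
      subst e1
      have e2' := QuotientAddGroup.mk_eq_mk_iff.1 (eq_of_heq e2)
      congr 1
      rw [QuotientAddGroup.mk_eq_mk_iff]
      have := (R j).sub_mem hc (hSR j e2')
      simpa using this

theorem aff_inc {c : G} {M : Line S} : Inc (.aff c : Point R) M ↔ ∃ j, M = .aff j c := by
  cases M with
  | inf j => simp [Inc]
  | aff j q =>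
    simp only [Inc]
    constructor
    · rintro rfl
      exact ⟨j, rfl⟩
    · rintro ⟨k, e⟩
      injection e with e1 e2
      subst e1
      exact eq_of_heq e2

theorem mid_eq_mid {i j : I} {a b : G} :
    (.mid i a : Point R) = .mid j b ↔ i = j ∧ b - a ∈ R i := by
  constructor
  · intro e
    injection e with e1 e2
    subst e1
    exact ⟨rfl, QuotientAddGroup.mk_eq_mk_iff.1 (eq_of_heq e2)⟩
  · rintro ⟨rfl, h⟩
    rw [QuotientAddGroup.mk_eq_mk_iff.2 h]

theorem aff_eq_aff {i j : I} {a b : G} :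
    (.aff i a : Line S) = .aff j b ↔ i = j ∧ b - a ∈ S i := by
  constructor
  · intro e
    injection e with e1 e2
    subst e1
    exact ⟨rfl, QuotientAddGroup.mk_eq_mk_iff.1 (eq_of_heq e2)⟩
  · rintro ⟨rfl, h⟩
    rw [QuotientAddGroup.mk_eq_mk_iff.2 h]

theorem Point.cases_mk {motive : Point R → Prop} (p : Point R) (apex : motive .apex)
    (mid : ∀ i (a : G), motive (.mid i a)) (aff : ∀ a, motive (.aff a)) : motive p := by
  cases p with
  | apex => exact apex
  | mid i q =>
    obtain ⟨a, rfl⟩ := QuotientAddGroup.mk_surjective q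
    exact mid i a
  | aff a => exact aff a

theorem Line.cases_mk {motive : Line S → Prop} (L : Line S) (inf : ∀ i, motive (.inf i))
    (aff : ∀ i (a : G), motive (.aff i a)) : motive L := by
  cases L with
  | inf i => exact inf i
  | aff i q =>
    obtain ⟨a, rfl⟩ := QuotientAddGroup.mk_surjective q
    exact aff i a

theorem eq_or_eq (h : IsKantorFamily ⊤ S R) {p q : Point R} {L M : Line S} (hpL : Inc p L)
    (hqL : Inc q L) (hpM : Inc p M) (hqM : Inc q M) : p = q ∨ L = M := by
  have hmix : ∀ (i j : I) (b : G) (p : Point R), Inc p (.inf i : Line S) →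
      Inc p (.aff j b : Line S) → p = .mid j b := by
    intro i j b p h1 h2
    rcases inc_inf.1 h1 with rfl | ⟨a, rfl⟩
    · simp [Inc] at h2
    · simpa [inc_line_aff h.le] using h2
  induction L using Line.cases_mk with
  | inf i =>
    induction M using Line.cases_mk with
    | inf j =>
      by_cases hij : i = j
      · exact Or.inr (hij ▸ rfl)
      · left
        have key : ∀ p : Point R, Inc p (.inf i : Line S) → Inc p (.inf j : Line S) →
            p = .apex := by
          intro p h1 h2
          rcases inc_inf.1 h1 with rfl | ⟨a, rfl⟩
          · rfl
          · exact absurd h2 hij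
        rw [key p hpL hpM, key q hqL hqM]
    | aff j b => exact Or.inl ((hmix i j b p hpL hpM).trans (hmix i j b q hqL hqM).symm)
  | aff i a =>
    induction M using Line.cases_mk with
    | inf j => exact Or.inl ((hmix j i a p hpM hpL).trans (hmix j i a q hqM hqL).symm)
    | aff j b =>
      have haff : ∀ c : G, Inc (.aff c : Point R) (.aff i a : Line S) →
          Inc (.aff c : Point R) (.aff j b : Line S) → i = j →
          (.aff i a : Line S) = .aff j b := by
        rintro c h1 h2 rfl
        have h1' : (a : G ⧸ S i) = c := h1
        have h2' : (b : G ⧸ S i) = c := h2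
        rw [h1', h2']
      rcases (inc_line_aff h.le).1 hpL with rfl | ⟨c, hc, rfl⟩
      · have hij : i = j := hpM.1
        rcases (inc_line_aff h.le).1 hqL with rfl | ⟨d, hd, rfl⟩
        · exact Or.inl rfl
        · exact Or.inr (haff d hqL hqM hij)
      · rcases (inc_line_aff h.le).1 hqL with rfl | ⟨d, hd, rfl⟩
        · exact Or.inr (haff c hpL hpM hqM.1)
        · by_cases hij : i = j
          · exact Or.inr (haff c hpL hpM hij)
          · left
            have hc' : c - b ∈ S j := QuotientAddGroup.mk_eq_mk_iff.1 hpM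
            have hd' : d - b ∈ S j := QuotientAddGroup.mk_eq_mk_iff.1 hqM
            have := h.disjoint' hij (by simpa using (S i).sub_mem hc hd)
              (by simpa using (S j).sub_mem hc' hd')
            rw [sub_eq_zero.1 this]

theorem exists_proj (h : IsKantorFamily ⊤ S R) (p : Point R) (L : Line S) (hpL : ¬ Inc p L) :
    ∃! f : Point R × Line S, Inc p f.2 ∧ Inc f.1 f.2 ∧ Inc f.1 L := by
  induction p using Point.cases_mk with
  | apex =>
    induction L using Line.cases_mk with
    | inf i => exact absurd trivial hpL
    | aff i b =>
      refine ⟨(.mid i b, .inf i), ⟨trivial, rfl, rfl, b, rfl, rfl⟩, ?_⟩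
      rintro ⟨q, M⟩ ⟨h1, h2, h3⟩
      obtain ⟨j, rfl⟩ := apex_inc.1 h1
      rcases (inc_line_aff h.le).1 h3 with rfl | ⟨c, hc, rfl⟩
      · have : i = j := h2
        rw [this]
      · exact h2.elim
  | mid i a =>
    induction L using Line.cases_mk with
    | inf j =>
      refine ⟨(.apex, .inf i), ⟨rfl, trivial, trivial⟩, ?_⟩
      rintro ⟨q, M⟩ ⟨h1, h2, h3⟩
      rcases inc_inf.1 h3 with rfl | ⟨b, rfl⟩
      · obtain ⟨k, rfl⟩ := apex_inc.1 h2
        have : i = k := h1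
        rw [this]
      · rcases (mid_inc h.le).1 h1 with rfl | ⟨c, hc, rfl⟩
        · exact absurd (Eq.symm h2) hpL
        · exact absurd h2.1.symm hpL
    | aff j b =>
      by_cases hij : i = j
      · subst hij
        refine ⟨(.mid i b, .inf i), ⟨rfl, rfl, rfl, b, rfl, rfl⟩, ?_⟩
        rintro ⟨q, M⟩ ⟨h1, h2, h3⟩
        rcases (mid_inc h.le).1 h1 with rfl | ⟨c, hc, rfl⟩
        · rcases (inc_line_aff h.le).1 h3 with rfl | ⟨d, hd, rfl⟩
          · rfl
          · exact h2.elim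
        · exfalso
          -- the line `c + S i` would meet `b + S i`, so that `a`, `b`, `c` agree modulo `R i`
          apply hpL
          rw [mid_inc h.le]
          refine Or.inr ⟨b, ?_, rfl⟩
          have hbc : c - b ∈ R i := by
            rcases (inc_line_aff h.le).1 h3 with rfl | ⟨d, hd, rfl⟩
            · rcases (inc_line_aff h.le).1 h2 with e | ⟨d, hd, e⟩
              · exact (mid_eq_mid.1 e).2
              · simp at e
            · have hd' : d - c ∈ S i := QuotientAddGroup.mk_eq_mk_iff.1 h2
              have := (S i).sub_mem hd hd'
              exact h.le i (by simpa using this)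
          have := (R i).sub_mem hc hbc
          simpa using this
      · obtain ⟨d, hd, hR⟩ := h.sum i j hij (a - b) trivial
        refine ⟨(.aff (b + d), .aff i ((b + d : G) : G ⧸ S i)), ⟨?_, rfl, ?_⟩, ?_⟩
        · refine (mid_inc h.le).2 (Or.inr ⟨b + d, ?_, rfl⟩)
          rw [← neg_mem_iff]
          convert hR using 1
          abel
        · exact (inc_line_aff h.le).2 (Or.inr ⟨b + d, by simpa using hd, rfl⟩)
        · rintro ⟨q, M⟩ ⟨h1, h2, h3⟩
          rcases (inc_line_aff h.le).1 h3 with rfl | ⟨c, hc, rfl⟩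
          · rcases (mid_inc h.le).1 h1 with rfl | ⟨e, he, rfl⟩
            · exact absurd (Eq.symm h2) hij
            · exact absurd h2.1.symm hij
          · obtain ⟨k, rfl⟩ := aff_inc.1 h2
            have hik : i = k := by
              rcases (mid_inc h.le).1 h1 with e | ⟨e, he, e'⟩
              · simp at e
              · exact (aff_eq_aff.1 e').1.symm
            subst hik
            have hca : c - a ∈ R i := by
              rcases (inc_line_aff h.le).1 h1 with e | ⟨e, he, e'⟩
              · exact (mid_eq_mid.1 e).2
              · simp at e'
            have : c - (b + d) = 0 := by
              refine h.disjoint i j hij _ ?_ ?_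
              · convert (R i).add_mem hca hR using 1
                abel
              · convert (S j).sub_mem hc hd using 1
                abel
            rw [sub_eq_zero.1 this]
  | aff c =>
    induction L using Line.cases_mk with
    | inf i =>
      refine ⟨(.mid i c, .aff i c), ⟨rfl, ⟨rfl, c, rfl, rfl⟩, rfl⟩, ?_⟩
      rintro ⟨q, M⟩ ⟨h1, h2, h3⟩
      obtain ⟨k, rfl⟩ := aff_inc.1 h1
      rcases inc_inf.1 h3 with rfl | ⟨b, rfl⟩
      · exact h2.elim
      · have hik : i = k := h2.1
        subst hik
        rcases (inc_line_aff h.le).1 h2 with e | ⟨e, he, e'⟩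
        · exact Prod.ext e rfl
        · simp at e'
    | aff j d =>
      have hcd : c - d ∉ S j := fun hmem => hpL ((inc_line_aff h.le).2 (Or.inr ⟨c, hmem, rfl⟩))
      by_cases hR : c - d ∈ R j
      · refine ⟨(.mid j d, .aff j c), ⟨rfl, ?_, rfl, d, rfl, rfl⟩, ?_⟩
        · exact (mid_inc h.le).2 (Or.inr ⟨c, hR, rfl⟩)
        · rintro ⟨q, M⟩ ⟨h1, h2, h3⟩
          obtain ⟨k, rfl⟩ := aff_inc.1 h1
          rcases (inc_line_aff h.le).1 h3 with rfl | ⟨b, hb, rfl⟩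
          · have : j = k := h2.1
            rw [this]
          · exfalso
            have hbc : b - c ∈ S k := QuotientAddGroup.mk_eq_mk_iff.1 h2
            have hbc0 : b - c = 0 ∨ j = k := by
              by_cases hjk : j = k
              · exact Or.inr hjk
              · left
                refine h.disjoint j k hjk _ ?_ hbc
                have := (R j).sub_mem (h.le j hb) hR
                simpa using this
            rcases hbc0 with e | rfl
            · exact hcd (sub_eq_zero.1 e ▸ hb)
            · have := (S j).sub_mem hb hbc
              exact hcd (by simpa using this)
      · obtain ⟨k, hk, a, ha, b, hb, e⟩ := h.split j (c - d) trivial hR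
        have hda : d + a - c = -b := by
          rw [← neg_eq_iff_eq_neg]
          rw [eq_sub_of_add_eq' e]
          abel
        refine ⟨(.aff (d + a), .aff k c), ⟨rfl, ?_, ?_⟩, ?_⟩
        · refine (inc_line_aff h.le).2 (Or.inr ⟨d + a, ?_, rfl⟩)
          rw [hda]
          exact (S k).neg_mem hb
        · exact (inc_line_aff h.le).2 (Or.inr ⟨d + a, by simpa using ha, rfl⟩)
        · rintro ⟨q, M⟩ ⟨h1, h2, h3⟩
          obtain ⟨l, rfl⟩ := aff_inc.1 h1
          rcases (inc_line_aff h.le).1 h3 with rfl | ⟨x, hx, rfl⟩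
          · exfalso
            have : j = l := h2.1
            subst this
            rcases (inc_line_aff h.le).1 h2 with e' | ⟨y, hy, e'⟩
            · exact hR (mid_eq_mid.1 e').2
            · simp at e'
          · have hxc : x - c ∈ S l := QuotientAddGroup.mk_eq_mk_iff.1 h2
            have hlj : l ≠ j := by
              rintro rfl
              have := (S l).sub_mem hx hxc
              exact hcd (by simpa using this)
            have hxa : x - d - a ∈ S j := (S j).sub_mem hx ha
            by_cases hlk : l = k
            · subst hlk
              have h0 : x - d - a = 0 := by
                refine h.disjoint' hlj.symm hxa ?_
                convert (S l).add_mem hxc hb using 1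
                rw [eq_sub_of_add_eq' e]
                abel
              rw [show x = d + a by rw [← sub_eq_zero, ← sub_sub]; exact h0]
            · exfalso
              have h0 := h.triangle' hk.symm hlj.symm (Ne.symm hlk) hxa ((S k).neg_mem hb) hxc (by
                rw [eq_sub_of_add_eq' e]
                abel)
              exact hR (by
                rw [← e, neg_eq_zero.1 h0.2.1, add_zero]
                exact h.le j ha)

theorem isGQ (h : IsKantorFamily ⊤ S R) : IsGQ (Inc : Point R → Line S → Prop) where
  nonempty := ⟨.apex⟩
  eq_or_eq _ _ _ _ := eq_or_eq h
  proj := exists_proj h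
  thick_line L := by
    induction L using Line.cases_mk with
    | inf i =>
      obtain ⟨j, hj⟩ := h.exists_ne i
      obtain ⟨a, ha, ha0⟩ := h.exists_ne_zero j
      refine Set.two_lt_encard_of_mem (a := Point.apex) (b := .mid i (0 : G)) (c := .mid i a)
        trivial rfl rfl (by simp) (by simp) fun e => ?_
      have := (mid_eq_mid.1 e).2
      rw [sub_zero] at this
      exact h.notMem_of_ne_zero hj.symm ha ha0 this
    | aff i b =>
      obtain ⟨a, ha, ha0⟩ := h.exists_ne_zero i
      refine Set.two_lt_encard_of_mem (a := Point.mid i b) (b := .aff b) (c := .aff (b + a))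
        ⟨rfl, b, rfl, rfl⟩ rfl ?_ (by simp) (by simp) (by simpa using ha0)
      exact (inc_line_aff h.le).2 (Or.inr ⟨_, by simpa using ha, rfl⟩)
  thick_point p := by
    obtain ⟨i, j, k, hij, hik, hjk⟩ := h.exists_three
    induction p using Point.cases_mk with
    | apex =>
      exact Set.two_lt_encard_of_mem (a := Line.inf i) (b := .inf j) (c := .inf k)
        trivial trivial trivial (by simpa) (by simpa) (by simpa)
    | mid i a =>
      obtain ⟨r, hr, hrS⟩ := h.exists_notMem i
      refine Set.two_lt_encard_of_mem (a := Line.inf i) (b := .aff i a)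
        (c := .aff i ((a + r : G) : G ⧸ S i)) rfl ⟨rfl, a, rfl, rfl⟩ ?_ (by simp) (by simp)
        fun e => ?_
      · exact (mid_inc h.le).2 (Or.inr ⟨_, by simpa using hr, rfl⟩)
      · have := (aff_eq_aff.1 e).2
        exact hrS (by simpa using this)
    | aff c =>
      exact Set.two_lt_encard_of_mem (a := Line.aff i c) (b := .aff j c) (c := .aff k c)
        rfl rfl rfl (fun e => hij (aff_eq_aff.1 e).1) (fun e => hik (aff_eq_aff.1 e).1)
        (fun e => hjk (aff_eq_aff.1 e).1)

end KantorGeometry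

/-! ### Translations of the quadrangle of a Kantor family -/

namespace KantorGeometry

variable {G I : Type*} [AddCommGroup G] {S R : I → AddSubgroup G}

/-- The action of a group element on the points. -/
def shiftPoint (g : G) : Point R → Point R
  | .apex => .apex
  | .mid i q => .mid i (g + q)
  | .aff a => .aff (g + a)

/-- The action of a group element on the lines. -/
def shiftLine (g : G) : Line S → Line S
  | .inf i => .inf i
  | .aff i q => .aff i (g + q)

theorem shiftPoint_zero (p : Point R) : shiftPoint 0 p = p := by
  cases p <;> simp [shiftPoint]

theorem shiftPoint_add (g g' : G) (p : Point R) :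
    shiftPoint (g + g') p = shiftPoint g (shiftPoint g' p) := by
  cases p <;> simp [shiftPoint, add_assoc]

theorem shiftLine_zero (L : Line S) : shiftLine 0 L = L := by
  cases L <;> simp [shiftLine]

theorem shiftLine_add (g g' : G) (L : Line S) :
    shiftLine (g + g') L = shiftLine g (shiftLine g' L) := by
  cases L <;> simp [shiftLine, add_assoc]

theorem inc_shift_of_inc (g : G) {p : Point R} {L : Line S} (h : Inc p L) :
    Inc (shiftPoint g p) (shiftLine g L) := by
  cases p <;> cases L
  · trivial
  · exact h.elim
  · exact h
  · obtain ⟨rfl, a, rfl, rfl⟩ := h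
    exact ⟨rfl, g + a, rfl, rfl⟩
  · exact h.elim
  · obtain rfl := (h : _ = _)
    rfl

theorem inc_shift (g : G) (p : Point R) (L : Line S) :
    Inc (shiftPoint g p) (shiftLine g L) ↔ Inc p L := by
  refine ⟨fun h => ?_, inc_shift_of_inc g⟩
  have := inc_shift_of_inc (-g) h
  rwa [← shiftPoint_add, ← shiftLine_add, neg_add_cancel, shiftPoint_zero, shiftLine_zero] at this

variable (S R) in
/-- The group acts on the quadrangle of a Kantor family by translations. -/
def translation : Multiplicative G →* Equiv.Perm (Point R) × Equiv.Perm (Line S) where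
  toFun g :=
    (⟨shiftPoint g.toAdd, shiftPoint (-g.toAdd),
        fun p => by rw [← shiftPoint_add, neg_add_cancel, shiftPoint_zero],
        fun p => by rw [← shiftPoint_add, add_neg_cancel, shiftPoint_zero]⟩,
      ⟨shiftLine g.toAdd, shiftLine (-g.toAdd),
        fun p => by rw [← shiftLine_add, neg_add_cancel, shiftLine_zero],
        fun p => by rw [← shiftLine_add, add_neg_cancel, shiftLine_zero]⟩)
  map_one' := by
    ext x
    · exact shiftPoint_zero x
    · exact shiftLine_zero x
  map_mul' g g' := by
    ext x
    · exact shiftPoint_add g.toAdd g'.toAdd x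
    · exact shiftLine_add g.toAdd g'.toAdd x

theorem not_collinear_apex_iff [Nonempty I] (p : Point R) :
    ¬ Collinear (Inc : Point R → Line S → Prop) .apex p ↔ ∃ a, p = .aff a := by
  constructor
  · intro h
    cases p with
    | apex => exact absurd ⟨.inf (Classical.arbitrary I), trivial, trivial⟩ h
    | mid i q => exact absurd ⟨.inf i, trivial, rfl⟩ h
    | aff a => exact ⟨a, rfl⟩
  · rintro ⟨a, rfl⟩ ⟨L, h1, h2⟩
    cases L with
    | inf i => exact h2
    | aff i q => exact h1

variable (h : IsKantorFamily ⊤ S R)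

/-- The translation generalized quadrangle of a Kantor family. -/
def toTGQ : TGQ (Point R) (Line S) where
  I := Inc
  isGQ := isGQ h
  x := .apex
  A := (translation S R).range
  le_aut := by
    rintro _ ⟨g, rfl⟩
    exact inc_shift g.toAdd
  comm := by
    rintro _ ⟨g, rfl⟩ _ ⟨g', rfl⟩
    rw [← map_mul, ← map_mul, mul_comm]
  fixes := by
    rintro _ ⟨g, rfl⟩ L hL
    obtain ⟨i, rfl⟩ := apex_inc.1 hL
    rfl
  sharp := by
    intro p q hp hq
    have : Nonempty I := ⟨h.exists_three.choose⟩
    obtain ⟨a, rfl⟩ := (not_collinear_apex_iff p).1 hp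
    obtain ⟨b, rfl⟩ := (not_collinear_apex_iff q).1 hq
    refine ⟨translation S R (Multiplicative.ofAdd (b - a)), ⟨⟨_, rfl⟩, ?_⟩, ?_⟩
    · exact congrArg Point.aff (sub_add_cancel b a)
    · rintro _ ⟨⟨g, rfl⟩, e⟩
      have e' : g.toAdd + a = b := Point.aff.inj e
      rw [← e', add_sub_cancel_right]
      rfl

theorem isAffine_iff (p : Point R) : (toTGQ h).IsAffine p ↔ ∃ a, p = .aff a :=
  have : Nonempty I := ⟨h.exists_three.choose⟩
  not_collinear_apex_iff p

/-- The translation group of the quadrangle of a Kantor family is the group of the family. -/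
noncomputable def translationEquiv : G ≃+ Additive (toTGQ h).A :=
  AddEquiv.ofBijective
    ({ toFun := fun g => Additive.ofMul ⟨translation S R (Multiplicative.ofAdd g), _, rfl⟩
       map_zero' := congrArg Additive.ofMul (Subtype.ext (map_one (translation S R)))
       map_add' := fun a b => congrArg Additive.ofMul (Subtype.ext
        (map_mul (translation S R) (Multiplicative.ofAdd a) (Multiplicative.ofAdd b))) } :
      G →+ Additive (toTGQ h).A)
    ⟨fun a b e => by
      have e1 : translation S R (Multiplicative.ofAdd a) =
          translation S R (Multiplicative.ofAdd b) :=
        congrArg Subtype.val (congrArg Additive.toMul e)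
      have e2 : (.aff (a + 0) : Point R) = .aff (b + 0) :=
        congrArg (fun f => f.1 (Point.aff 0)) e1
      simpa using e2, by
      rintro ⟨_, ⟨g, rfl⟩⟩
      exact ⟨g.toAdd, rfl⟩⟩

theorem translationEquiv_mem_lineStab (g : G) (i : I) (q : G ⧸ S i) :
    translationEquiv h g ∈ (toTGQ h).lineStab (.aff i q) ↔ g ∈ S i := by
  change (.aff i (g + q) : Line S) = .aff i q ↔ _
  rw [Line.aff.injEq]
  simp

theorem mem_kernel_iff (ξ : AddMonoid.End (Additive (toTGQ h).A)) :
    ξ ∈ (toTGQ h).kernel ↔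
      ∀ i, ∀ a ∈ S i, (translationEquiv h).symm (ξ (translationEquiv h a)) ∈ S i := by
  rw [(toTGQ h).mem_kernel_iff ((isAffine_iff h (.aff 0)).2 ⟨0, rfl⟩)]
  constructor
  · intro H i a ha
    have := H (.aff i (0 : G)) rfl _ ((translationEquiv_mem_lineStab h a i (0 : G)).2 ha)
    rw [← (translationEquiv h).apply_symm_apply (ξ _), translationEquiv_mem_lineStab] at this
    exact this
  · intro H U hU a ha
    obtain ⟨i, rfl⟩ := aff_inc.1 hU
    rw [← (translationEquiv h).apply_symm_apply a, translationEquiv_mem_lineStab] at ha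
    have := H i _ ha
    rw [← translationEquiv_mem_lineStab h _ i (0 : G), AddEquiv.apply_symm_apply,
      AddEquiv.apply_symm_apply] at this
    exact this

/-- An endomorphism of the translation group, as an endomorphism of the group of the family. -/
noncomputable def conjEnd (ξ : AddMonoid.End (Additive (toTGQ h).A)) : G →+ G :=
  ((translationEquiv h).symm.toAddMonoidHom.comp ξ).comp (translationEquiv h).toAddMonoidHom

theorem conjEnd_apply (ξ : AddMonoid.End (Additive (toTGQ h).A)) (a : G) :
    conjEnd h ξ a = (translationEquiv h).symm (ξ (translationEquiv h a)) := rfl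

theorem conjEnd_eq_zero_iff (ξ : AddMonoid.End (Additive (toTGQ h).A)) :
    conjEnd h ξ = 0 ↔ ξ = 0 := by
  constructor
  · intro e
    refine AddMonoidHom.ext fun a => ?_
    have := DFunLike.congr_fun e ((translationEquiv h).symm a)
    rw [conjEnd_apply, AddEquiv.apply_symm_apply] at this
    exact (translationEquiv h).symm.map_eq_zero_iff.1 this
  · rintro rfl
    exact AddMonoidHom.ext fun a => map_zero (translationEquiv h).symm

/-- If the nonzero kernel elements of a Kantor family are bijective, then the quadrangle is
linear. -/
theorem isLinear
    (hbij : ∀ ξ : G →+ G, (∀ i, ∀ a ∈ S i, ξ a ∈ S i) → ξ ≠ 0 → Function.Bijective ξ) :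
    (toTGQ h).IsLinear := by
  constructor
  · refine ⟨0, 1, fun e => ?_⟩
    obtain ⟨i, -⟩ := h.exists_three
    obtain ⟨a, -, ha⟩ := h.exists_ne_zero i
    have := DFunLike.congr_fun (congrArg Subtype.val e) (translationEquiv h a)
    exact ha ((translationEquiv h).map_eq_zero_iff.1 this.symm)
  · intro ξ hξ
    have hK := (mem_kernel_iff h ξ.1).1 ξ.2
    have hne : conjEnd h ξ.1 ≠ 0 := fun e => hξ (Subtype.ext ((conjEnd_eq_zero_iff h _).1 e))
    have hb := hbij (conjEnd h ξ.1) hK hne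
    let η : G ≃+ G := AddEquiv.ofBijective (conjEnd h ξ.1) hb
    let ζ : AddMonoid.End (Additive (toTGQ h).A) :=
      (((translationEquiv h).toAddMonoidHom.comp η.symm.toAddMonoidHom).comp
        (translationEquiv h).symm.toAddMonoidHom)
    have hζv : ∀ v, ζ v = translationEquiv h (η.symm ((translationEquiv h).symm v)) :=
      fun v => rfl
    have hζ : ζ ∈ (toTGQ h).kernel := by
      rw [mem_kernel_iff]
      intro i a ha
      have : (translationEquiv h).symm (ζ (translationEquiv h a)) = η.symm a := by
        rw [hζv, AddEquiv.symm_apply_apply, AddEquiv.symm_apply_apply]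
      rw [this]
      refine h.mem_of_map_mem (ξ := conjEnd h ξ.1) hK hb.1 ?_
      rw [show conjEnd h ξ.1 (η.symm a) = a from η.apply_symm_apply a]
      exact ha
    have key : ∀ v, (ξ.1 : Additive (toTGQ h).A → _) v
        = translationEquiv h (η ((translationEquiv h).symm v)) := by
      intro v
      change _ = translationEquiv h (conjEnd h ξ.1 _)
      rw [conjEnd_apply, AddEquiv.apply_symm_apply, AddEquiv.apply_symm_apply]
    refine ⟨⟨ξ, ⟨ζ, hζ⟩, ?_, ?_⟩, rfl⟩
    · apply Subtype.ext
      refine AddMonoidHom.ext fun v => ?_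
      change ξ.1 (ζ v) = v
      rw [key, hζv, AddEquiv.symm_apply_apply, AddEquiv.apply_symm_apply,
        AddEquiv.apply_symm_apply]
    · apply Subtype.ext
      refine AddMonoidHom.ext fun v => ?_
      change ζ (ξ.1 v) = v
      rw [key, hζv, AddEquiv.symm_apply_apply, AddEquiv.symm_apply_apply,
        AddEquiv.apply_symm_apply]

end KantorGeometry

/-! ### Projective representations -/

namespace KantorGeometry

section Cone

variable {K V : Type*} [DivisionRing K] [AddCommGroup V] [Module K V]

/-- The subspace of `K × V` spanned by the affine points `(1, v)` with `v` in the coset `a + H`,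
together with its part `0 × H` at infinity. -/
def cone (H : Submodule K V) (a : V) : Submodule K (K × V) :=
  H.comap (LinearMap.snd K K V - (LinearMap.fst K K V).smulRight a)

theorem mem_cone {H : Submodule K V} {a : V} {x : K × V} :
    x ∈ cone H a ↔ x.2 - x.1 • a ∈ H := Iff.rfl

theorem cone_inf_infinity (H : Submodule K V) (a : V) :
    cone H a ⊓ TGQ.infinity K V = cone H 0 ⊓ TGQ.infinity K V := by
  ext ⟨c, w⟩
  simp only [Submodule.mem_inf, mem_cone, TGQ.infinity, LinearMap.mem_ker, LinearMap.fst_apply]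
  refine and_congr_left fun hc => ?_
  rw [hc, zero_smul, zero_smul]

/-- The affine point `(1, v)` of the projective space. -/
def affinePoint (K : Type*) {V : Type*} [DivisionRing K] [AddCommGroup V] [Module K V] (v : V) :
    Projectivization K (K × V) :=
  Projectivization.mk K ((1 : K), v) fun e => one_ne_zero (congrArg Prod.fst e)

theorem affinePoint_le_iff {W : Submodule K (K × V)} {v : V} :
    (affinePoint K v).submodule ≤ W ↔ ((1 : K), v) ∈ W := by
  rw [affinePoint, Projectivization.submodule_mk, Submodule.span_singleton_le_iff_mem]

theorem affinePoint_le_cone_iff {H : Submodule K V} {a v : V} :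
    (affinePoint K v).submodule ≤ cone H a ↔ v - a ∈ H := by
  rw [affinePoint_le_iff, mem_cone, one_smul]

theorem affinePoint_injective : Function.Injective (affinePoint K (V := V)) := by
  intro v w e
  rw [affinePoint, affinePoint, Projectivization.mk_eq_mk_iff'] at e
  obtain ⟨c, hc⟩ := e
  have h1 : c * 1 = 1 := congrArg Prod.fst hc
  have h2 : c • w = v := congrArg Prod.snd hc
  rw [← h2, show c = 1 by simpa using h1, one_smul]

theorem exists_affinePoint_eq {Q : Projectivization K (K × V)}
    (hQ : ¬ Q.submodule ≤ TGQ.infinity K V) : ∃ v, affinePoint K v = Q := by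
  induction Q using Projectivization.ind with
  | h x hx =>
    obtain ⟨c, w⟩ := x
    rw [Projectivization.submodule_mk, Submodule.span_singleton_le_iff_mem] at hQ
    have hc : c ≠ 0 := hQ
    refine ⟨c⁻¹ • w, ?_⟩
    rw [affinePoint, Projectivization.mk_eq_mk_iff']
    exact ⟨c⁻¹, by simp [hc]⟩

theorem not_affinePoint_le_infinity (v : V) : ¬ (affinePoint K v).submodule ≤ TGQ.infinity K V := by
  rw [affinePoint_le_iff]
  exact one_ne_zero (α := K)

theorem map_affinePoint (v w : V) :
    Projectivization.map (TGQ.translationMap K v) (TGQ.translationMap_injective K v)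
      (affinePoint K w) = affinePoint K (v + w) := by
  have e : TGQ.translationMap K v ((1 : K), w) = (1, v + w) := by
    refine Prod.ext rfl ?_
    change w + (1 : K) • v = v + w
    rw [one_smul, add_comm]
  simp only [affinePoint, Projectivization.map_mk, e]

end Cone

variable {G I : Type*} [AddCommGroup G] {S R : I → AddSubgroup G}

/-- The quadrangle of a Kantor family has a projective representation over its kernel, if that is a
division ring: the affine points are the vectors of the translation group, and lines and points at
infinity are represented by the cosets of the members and of the tangent groups. -/
theorem nonempty_projectiveRepresentation {K V : Type*} [DivisionRing K] [AddCommGroup V]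
    [Module K V] (h : IsKantorFamily ⊤ S R)
    (h4 : ∀ i j : I, ∃ k l, i ≠ k ∧ i ≠ l ∧ j ≠ k ∧ j ≠ l ∧ k ≠ l)
    (scalar : K ≃+* (toTGQ h).kernel) (τ : Additive (toTGQ h).A ≃+ V)
    (hτ : ∀ (k : K) (a : Additive (toTGQ h).A),
      τ ((scalar k : AddMonoid.End (Additive (toTGQ h).A)) a) = k • τ a) :
    Nonempty ((toTGQ h).ProjectiveRepresentation K V) := by
  let e : G ≃+ V := (translationEquiv h).trans τ
  have he : ∀ k a, k • e a = e (conjEnd h (scalar k).1 a) := fun k a => by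
    change k • τ (translationEquiv h a) = τ (translationEquiv h (conjEnd h (scalar k).1 a))
    rw [conjEnd_apply, AddEquiv.apply_symm_apply, hτ]
  have hK := fun k => (mem_kernel_iff h (scalar k).1).1 (scalar k).2
  let HS : I → Submodule K V := fun i =>
    { (S i).map e.toAddMonoidHom with
      smul_mem' := by
        rintro k _ ⟨a, ha, rfl⟩
        exact ⟨_, hK k i a ha, (he k a).symm⟩ }
  let HR : I → Submodule K V := fun i =>
    { (R i).map e.toAddMonoidHom with
      smul_mem' := by
        rintro k _ ⟨a, ha, rfl⟩
        refine ⟨conjEnd h (scalar k).1 a, ?_, (he k a).symm⟩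
        rcases h.eq_zero_or_injective h4 (ξ := conjEnd h (scalar k).1) (hK k) with h0 | hinj
        · rw [h0]
          exact (R i).zero_mem
        · exact h.map_mem_tangent (ξ := conjEnd h (scalar k).1) (hK k) hinj ha }
  have mS : ∀ i g, e g ∈ HS i ↔ g ∈ S i := fun i g =>
    ⟨fun ⟨a, ha, hag⟩ => e.injective hag ▸ ha, fun hg => ⟨g, hg, rfl⟩⟩
  have mR : ∀ i g, e g ∈ HR i ↔ g ∈ R i := fun i g =>
    ⟨fun ⟨a, ha, hag⟩ => e.injective hag ▸ ha, fun hg => ⟨g, hg, rfl⟩⟩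
  refine ⟨
    { scalar := scalar
      translation := τ
      translation_scalar := hτ
      point := fun p => match p with
        | .aff a => affinePoint K (e a)
        | _ => affinePoint K 0
      point_bij := ?_
      point_translation := ?_
      line := fun L => match L with
        | .inf i => cone (HS i) 0 ⊓ TGQ.infinity K V
        | .aff i q => cone (HS i) (e q.out)
      mem_line := ?_
      egg := ?_
      pointSpace := fun p => match p with
        | .mid i q => cone (HR i) (e q.out)
        | _ => ⊥
      mem_pointSpace := ?_
      tangent := ?_ }⟩
  · refine ⟨?_, ?_, ?_⟩
    · intro p hp
      obtain ⟨a, rfl⟩ := (isAffine_iff h p).1 hp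
      exact not_affinePoint_le_infinity _
    · intro p hp q hq hpq
      obtain ⟨a, rfl⟩ := (isAffine_iff h p).1 hp
      obtain ⟨b, rfl⟩ := (isAffine_iff h q).1 hq
      rw [e.injective (affinePoint_injective hpq)]
    · intro Q hQ
      obtain ⟨v, rfl⟩ := exists_affinePoint_eq hQ
      exact ⟨.aff (e.symm v), (isAffine_iff h _).2 ⟨_, rfl⟩,
        congrArg (affinePoint K) (e.apply_symm_apply v)⟩
  · intro a p hp
    obtain ⟨b, rfl⟩ := (isAffine_iff h p).1 hp
    obtain ⟨g, rfl⟩ := (translationEquiv h).surjective a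
    change affinePoint K (e (g + b)) = Projectivization.map _ _ (affinePoint K (e b))
    rw [map_affinePoint, map_add]
    rfl
  · intro L hL p hp
    obtain ⟨b, rfl⟩ := (isAffine_iff h p).1 hp
    cases L with
    | inf i => exact absurd trivial hL
    | aff i q =>
      refine Iff.trans ?_ affinePoint_le_cone_iff.symm
      rw [← map_sub, mS, ← QuotientAddGroup.mk_eq_mk_iff, QuotientAddGroup.out_eq']
      rfl
  · rintro L M hL hM ⟨m, hmL, hmM⟩
    obtain ⟨i, rfl⟩ := apex_inc.1 hL
    cases M with
    | inf j => exact absurd trivial hM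
    | aff j q =>
      obtain ⟨b, rfl⟩ := QuotientAddGroup.mk_surjective q
      have : i = j := by
        rcases (inc_line_aff h.le).1 hmM with rfl | ⟨c, hc, rfl⟩
        · exact Eq.symm hmL
        · exact hmL.elim
      subst this
      exact cone_inf_infinity _ _
  · rintro m hm ⟨L, hL, hmL⟩ p hp
    obtain ⟨b, rfl⟩ := (isAffine_iff h p).1 hp
    obtain ⟨i, rfl⟩ := apex_inc.1 hL
    cases m with
    | apex => exact absurd rfl hm
    | aff a => exact hmL.elim
    | mid j q =>
      refine Iff.trans ?_ affinePoint_le_cone_iff.symm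
      rw [← map_sub, mR, ← QuotientAddGroup.mk_eq_mk_iff, QuotientAddGroup.out_eq']
      constructor
      · rintro ⟨M, hM1, hM2⟩
        obtain ⟨k, rfl⟩ := aff_inc.1 hM2
        obtain ⟨rfl, d, rfl, hd⟩ := hM1
        rw [QuotientAddGroup.mk_eq_mk_iff] at hd ⊢
        have := (R j).neg_mem (h.le j hd)
        rwa [neg_sub] at this
      · rintro rfl
        exact ⟨.aff j b, ⟨rfl, b, rfl, rfl⟩, rfl⟩
  · intro L m m' hL hm hm' hne hne'
    obtain ⟨i, rfl⟩ := apex_inc.1 hL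
    cases m with
    | apex => exact absurd rfl hne
    | aff a => exact hm.elim
    | mid j q =>
      cases m' with
      | apex => exact absurd rfl hne'
      | aff a => exact hm'.elim
      | mid k r =>
        obtain rfl : j = i := hm
        obtain rfl : k = j := hm'
        exact (cone_inf_infinity _ _).trans (cone_inf_infinity _ _).symm

end KantorGeometry

/-! ### The Kantor family of a translation generalized quadrangle -/

theorem Set.exists_mem_ne_ne_of_two_lt_encard {α : Type*} {s : Set α} (hs : 2 < s.encard)
    (a b : α) : ∃ c ∈ s, c ≠ a ∧ c ≠ b := by
  by_contra! hc
  have hle : s.encard ≤ ({a, b} : Set α).encard := Set.encard_le_encard fun c hcs => by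
    by_cases h : c = a
    · exact Or.inl h
    · exact Or.inr (hc c hcs h)
  exact absurd (hs.trans_le (hle.trans ((Set.encard_insert_le _ _).trans (by
    rw [Set.encard_singleton]; norm_num)))) (lt_irrefl _)

theorem Set.nonempty_of_two_lt_encard {α : Type*} {s : Set α} (hs : 2 < s.encard) :
    s.Nonempty :=
  Set.nonempty_of_encard_ne_zero (zero_lt_two.trans hs).ne'

namespace Quadrangle.IsGQ

variable {P B : Type*} {I : P → B → Prop}

theorem proj_unique (h : IsGQ I) {p q q' : P} {L M M' : B} (hpL : ¬ I p L) (hpM : I p M)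
    (hqM : I q M) (hqL : I q L) (hpM' : I p M') (hqM' : I q' M') (hqL' : I q' L) :
    q = q' ∧ M = M' := by
  have := (h.proj p L hpL).unique (y₁ := (q, M)) (y₂ := (q', M')) ⟨hpM, hqM, hqL⟩
    ⟨hpM', hqM', hqL'⟩
  exact Prod.mk.inj this

end Quadrangle.IsGQ

namespace TGQ

variable {P B : Type*} (T : TGQ P B)

/-- The action of the translation group, written additively, on the points. -/
def actPoint (a : Additive T.A) (p : P) : P := a.toMul.1.1 p

/-- The action of the translation group, written additively, on the lines. -/
def actLine (a : Additive T.A) (L : B) : B := a.toMul.1.2 L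

variable {T}

@[simp] theorem actPoint_zero (p : P) : T.actPoint 0 p = p := rfl

@[simp] theorem actLine_zero (L : B) : T.actLine 0 L = L := rfl

theorem actPoint_add (a b : Additive T.A) (p : P) :
    T.actPoint (a + b) p = T.actPoint a (T.actPoint b p) := rfl

theorem actLine_add (a b : Additive T.A) (L : B) :
    T.actLine (a + b) L = T.actLine a (T.actLine b L) := rfl

theorem inc_act (a : Additive T.A) (p : P) (L : B) :
    T.I (T.actPoint a p) (T.actLine a L) ↔ T.I p L :=
  T.le_aut a.toMul.2 p L

theorem actLine_of_inc (a : Additive T.A) {L : B} (hL : T.I T.x L) : T.actLine a L = L :=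
  T.fixes _ a.toMul.2 L hL

theorem inc_actPoint_iff (a : Additive T.A) (p : P) {L : B} (hL : T.I T.x L) :
    T.I (T.actPoint a p) L ↔ T.I p L := by
  conv_lhs => rw [← actLine_of_inc a hL]
  exact inc_act a p L

theorem actPoint_eq_iff {a b : Additive T.A} {p q : P} :
    T.actPoint a p = T.actPoint b q ↔ T.actPoint (a - b) p = q := by
  constructor
  · intro h
    rw [sub_eq_neg_add, actPoint_add, h, ← actPoint_add, neg_add_cancel, actPoint_zero]
  · intro h
    rw [← h, ← actPoint_add, add_sub_cancel]

theorem actLine_eq_iff {a b : Additive T.A} {L M : B} :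
    T.actLine a L = T.actLine b M ↔ T.actLine (a - b) L = M := by
  constructor
  · intro h
    rw [sub_eq_neg_add, actLine_add, h, ← actLine_add, neg_add_cancel, actLine_zero]
  · intro h
    rw [← h, ← actLine_add, add_sub_cancel]

theorem inc_act_iff {a b : Additive T.A} {p : P} {L : B} :
    T.I (T.actPoint a p) (T.actLine b L) ↔ T.I (T.actPoint (a - b) p) L := by
  rw [← inc_act b (T.actPoint (a - b) p), ← actPoint_add, add_sub_cancel]

theorem actPoint_x (a : Additive T.A) : T.actPoint a T.x = T.x := by
  obtain ⟨L, hL⟩ := Set.nonempty_of_two_lt_encard (T.isGQ.thick_point T.x)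
  obtain ⟨M, hM, hML, -⟩ := Set.exists_mem_ne_ne_of_two_lt_encard (T.isGQ.thick_point T.x) L L
  exact (T.isGQ.eq_or_eq _ _ L M ((inc_actPoint_iff a T.x hL).2 hL) hL
    ((inc_actPoint_iff a T.x hM).2 hM) hM).resolve_right hML.symm

theorem isAffine_act (a : Additive T.A) {p : P} (hp : T.IsAffine p) :
    T.IsAffine (T.actPoint a p) := by
  rintro ⟨L, hx, hL⟩
  exact hp ⟨L, hx, (inc_actPoint_iff a p hx).1 hL⟩

theorem exists_actPoint_eq {z p : P} (hz : T.IsAffine z) (hp : T.IsAffine p) :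
    ∃ a : Additive T.A, T.actPoint a z = p := by
  obtain ⟨a, ⟨ha, e⟩, -⟩ := T.sharp z p hz hp
  exact ⟨Additive.ofMul ⟨a, ha⟩, e⟩

theorem eq_zero_of_actPoint {z : P} (hz : T.IsAffine z) {a : Additive T.A}
    (ha : T.actPoint a z = z) : a = 0 := by
  have := (T.sharp z z hz hz).unique (y₁ := a.toMul.1) (y₂ := 1) ⟨a.toMul.2, ha⟩
    ⟨T.A.one_mem, rfl⟩
  exact congrArg Additive.ofMul (Subtype.ext this)

/-- All points but one of a line not on the translation point are affine. -/
theorem isAffine_of_ne {q r : P} {L M : B} (hM : ¬ T.I T.x M) (hL : T.I T.x L) (hqL : T.I q L)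
    (hqM : T.I q M) (hr : T.I r M) (hne : r ≠ q) : T.IsAffine r := by
  rintro ⟨N, hxN, hrN⟩
  exact hne (T.isGQ.proj_unique hM hxN hrN hr hL hqL hqM).1

theorem exists_isAffine (T : TGQ P B) : ∃ z, T.IsAffine z := by
  obtain ⟨L, hL⟩ := Set.nonempty_of_two_lt_encard (T.isGQ.thick_point T.x)
  obtain ⟨q, hq, hqx, -⟩ := Set.exists_mem_ne_ne_of_two_lt_encard (T.isGQ.thick_line L) T.x T.x
  obtain ⟨M, hM, hML, -⟩ := Set.exists_mem_ne_ne_of_two_lt_encard (T.isGQ.thick_point q) L L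
  obtain ⟨r, hr, hrq, -⟩ := Set.exists_mem_ne_ne_of_two_lt_encard (T.isGQ.thick_line M) q q
  refine ⟨r, isAffine_of_ne (fun hxM => ?_) hL hq hM hr hrq⟩
  exact (T.isGQ.eq_or_eq _ _ L M hq hL hM hxM).elim hqx fun e => hML e.symm

variable (T) in
/-- The lines on the translation point. -/
abbrev Direction : Type _ := {L : B // T.I T.x L}

theorem exists_foot {z : P} (hz : T.IsAffine z) (i : T.Direction) :
    ∃ f : P × B, T.I z f.2 ∧ T.I f.1 f.2 ∧ T.I f.1 i.1 :=
  (T.isGQ.proj z i.1 fun h => hz ⟨i.1, i.2, h⟩).exists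

/-- The projection of the affine point `z` onto a line on the translation point. -/
noncomputable def foot {z : P} (hz : T.IsAffine z) (i : T.Direction) : P :=
  (exists_foot hz i).choose.1

/-- The line on the affine point `z` that is concurrent with a given line on the translation
point. -/
noncomputable def ray {z : P} (hz : T.IsAffine z) (i : T.Direction) : B :=
  (exists_foot hz i).choose.2

/-- The stabilizers of the lines on an affine point. -/
noncomputable def member {z : P} (hz : T.IsAffine z) (i : T.Direction) :
    AddSubgroup (Additive T.A) :=
  T.lineStab (ray hz i)

/-- The stabilizers of the points that are collinear with an affine point and with the translation
point. -/
noncomputable def tangent {z : P} (hz : T.IsAffine z) (i : T.Direction) :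
    AddSubgroup (Additive T.A) where
  carrier := {a | T.actPoint a (foot hz i) = foot hz i}
  zero_mem' := rfl
  add_mem' := by
    intro a b ha hb
    change T.actPoint (a + b) _ = _
    rw [actPoint_add, show T.actPoint b (foot hz i) = foot hz i from hb]
    exact ha
  neg_mem' := by
    intro a ha
    change T.actPoint (-a) _ = _
    conv_lhs => rw [← show T.actPoint a (foot hz i) = foot hz i from ha]
    rw [← actPoint_add, neg_add_cancel, actPoint_zero]

section Coordinates

variable {z : P} {hz : T.IsAffine z}

theorem base_inc_ray (i : T.Direction) : T.I z (ray hz i) := (exists_foot hz i).choose_spec.1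

theorem foot_inc_ray (i : T.Direction) : T.I (foot hz i) (ray hz i) :=
  (exists_foot hz i).choose_spec.2.1

theorem foot_inc (i : T.Direction) : T.I (foot hz i) i.1 := (exists_foot hz i).choose_spec.2.2

theorem not_x_inc_ray (i : T.Direction) : ¬ T.I T.x (ray hz i) :=
  fun h => hz ⟨_, h, base_inc_ray i⟩

theorem x_ne_foot (i : T.Direction) : T.x ≠ foot hz i := fun e =>
  not_x_inc_ray (hz := hz) i (e ▸ foot_inc_ray i)

theorem not_x_inc_act_ray (a : Additive T.A) (i : T.Direction) :
    ¬ T.I T.x (T.actLine a (ray hz i)) := by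
  rw [← actPoint_x a, inc_act]
  exact not_x_inc_ray i

theorem act_foot_inc (a : Additive T.A) (i : T.Direction) :
    T.I (T.actPoint a (foot hz i)) i.1 := (inc_actPoint_iff a _ i.2).2 (foot_inc i)

theorem act_foot_ne_x (a : Additive T.A) (i : T.Direction) :
    T.actPoint a (foot hz i) ≠ T.x := by
  rw [← actPoint_x a]
  exact fun e => x_ne_foot (hz := hz) i (a.toMul.1.1.injective e).symm

/-- The line on the affine point `a z` that is concurrent with a line on the translation point is the
image under `a` of the corresponding line on `z`. -/
theorem eq_act_foot {a : Additive T.A} {i : T.Direction} {q : P} {M : B}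
    (h1 : T.I (T.actPoint a z) M) (h2 : T.I q M) (h3 : T.I q i.1) :
    q = T.actPoint a (foot hz i) ∧ M = T.actLine a (ray hz i) :=
  T.isGQ.proj_unique (fun h => isAffine_act a hz ⟨i.1, i.2, h⟩) h1 h2 h3
    ((inc_act a _ _).2 (base_inc_ray i)) ((inc_act a _ _).2 (foot_inc_ray i)) (act_foot_inc a i)

/-- If `m` is a point at infinity on the line `i` and lies on a line meeting the line `j` on the
translation point, then there is no triangle, so `i = j` and `m` is the common point. -/
theorem direction_eq {a b : Additive T.A} {i j : T.Direction}
    (h : T.I (T.actPoint a (foot hz i)) (T.actLine b (ray hz j))) :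
    i = j ∧ T.actPoint a (foot hz i) = T.actPoint b (foot hz j) := by
  have := T.isGQ.proj_unique (not_x_inc_act_ray b j) i.2 (act_foot_inc a i) h j.2
    (act_foot_inc b j) ((inc_act b _ _).2 (foot_inc_ray j))
  exact ⟨Subtype.ext this.2, this.1⟩

theorem mem_tangent {a : Additive T.A} {i : T.Direction} :
    a ∈ tangent hz i ↔ T.actPoint a (foot hz i) = foot hz i := Iff.rfl

theorem mem_member {a : Additive T.A} {i : T.Direction} :
    a ∈ member hz i ↔ T.actLine a (ray hz i) = ray hz i := Iff.rfl

theorem mem_member_iff {a : Additive T.A} {i : T.Direction} :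
    a ∈ member hz i ↔ T.I (T.actPoint a z) (ray hz i) := by
  constructor
  · intro h
    rw [← mem_member.1 h, inc_act]
    exact base_inc_ray i
  · intro h
    exact (eq_act_foot h (foot_inc_ray i) (foot_inc i)).2.symm

theorem member_le_tangent (i : T.Direction) : member hz i ≤ tangent hz i := fun _ h =>
  (eq_act_foot (mem_member_iff.1 h) (foot_inc_ray i) (foot_inc i)).1.symm

theorem base_inc_act_ray {a b : Additive T.A} {i : T.Direction} :
    T.I (T.actPoint a z) (T.actLine b (ray hz i)) ↔ a - b ∈ member hz i := by
  rw [inc_act_iff, mem_member_iff]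

theorem act_foot_eq_iff {a b : Additive T.A} {i j : T.Direction} :
    T.actPoint a (foot hz i) = T.actPoint b (foot hz j) ↔ i = j ∧ a - b ∈ tangent hz i := by
  constructor
  · intro e
    have hij : i = j := by
      refine (direction_eq (hz := hz) (a := a) (b := b) ?_).1
      rw [e, inc_act]
      exact foot_inc_ray j
    subst hij
    exact ⟨rfl, actPoint_eq_iff.1 e⟩
  · rintro ⟨rfl, h⟩
    exact actPoint_eq_iff.2 h

theorem act_ray_eq_iff {a b : Additive T.A} {i j : T.Direction} :
    T.actLine a (ray hz i) = T.actLine b (ray hz j) ↔ i = j ∧ a - b ∈ member hz i := by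
  constructor
  · intro e
    have hij : i = j := by
      refine (direction_eq (hz := hz) (a := a) (b := b) ?_).1
      rw [← e, inc_act]
      exact foot_inc_ray i
    subst hij
    exact ⟨rfl, actLine_eq_iff.1 e⟩
  · rintro ⟨rfl, h⟩
    exact actLine_eq_iff.2 h

theorem act_foot_inc_act_ray {a b : Additive T.A} {i j : T.Direction} :
    T.I (T.actPoint a (foot hz i)) (T.actLine b (ray hz j)) ↔ i = j ∧ a - b ∈ tangent hz i := by
  constructor
  · intro h
    exact act_foot_eq_iff.1 (direction_eq h).2
  · intro h
    rw [act_foot_eq_iff.2 h, inc_act]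
    exact foot_inc_ray j

theorem exists_eq_act_foot {q : P} (i : T.Direction) (hq : T.I q i.1) (hqx : q ≠ T.x) :
    ∃ a, q = T.actPoint a (foot hz i) := by
  obtain ⟨M, hM, hMi, -⟩ := Set.exists_mem_ne_ne_of_two_lt_encard (T.isGQ.thick_point q) i.1 i.1
  obtain ⟨r, hr, hrq, -⟩ := Set.exists_mem_ne_ne_of_two_lt_encard (T.isGQ.thick_line M) q q
  have hxM : ¬ T.I T.x M := fun hxM =>
    (T.isGQ.eq_or_eq _ _ i.1 M hq i.2 hM hxM).elim hqx fun e => hMi e.symm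
  obtain ⟨a, rfl⟩ := exists_actPoint_eq hz (isAffine_of_ne hxM i.2 hq hM hr hrq)
  exact ⟨a, (eq_act_foot hr hM hq).1⟩

theorem exists_eq_act_ray {M : B} (hM : ¬ T.I T.x M) :
    ∃ a i, M = T.actLine a (ray hz i) := by
  obtain ⟨⟨q, L⟩, hL, hqL, hqM⟩ := (T.isGQ.proj T.x M hM).exists
  obtain ⟨r, hr, hrq, -⟩ := Set.exists_mem_ne_ne_of_two_lt_encard (T.isGQ.thick_line M) q q
  obtain ⟨a, rfl⟩ := exists_actPoint_eq hz (isAffine_of_ne hM hL hqL hqM hr hrq)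
  exact ⟨a, ⟨L, hL⟩, (eq_act_foot (i := ⟨L, hL⟩) hr hqM hqL).2⟩

theorem exists_eq_act_ray_of_inc {c : Additive T.A} {M : B} (h : T.I (T.actPoint c z) M) :
    ∃ i, M = T.actLine c (ray hz i) := by
  obtain ⟨a, i, rfl⟩ := exists_eq_act_ray (hz := hz) (M := M)
    fun hM => isAffine_act c hz ⟨M, hM, h⟩
  exact ⟨i, (act_ray_eq_iff.2 ⟨rfl, base_inc_act_ray.1 h⟩).symm⟩

theorem eq_foot_or_eq_act {q : P} {i : T.Direction} (hq : T.I q (ray hz i)) :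
    q = foot hz i ∨ ∃ a ∈ member hz i, q = T.actPoint a z := by
  by_cases h : q = foot hz i
  · exact Or.inl h
  · right
    obtain ⟨a, rfl⟩ := exists_actPoint_eq hz
      (isAffine_of_ne (not_x_inc_ray i) i.2 (foot_inc i) (foot_inc_ray i) hq h)
    exact ⟨a, mem_member_iff.2 hq, rfl⟩

theorem ray_injective : Function.Injective (ray hz) := by
  intro i j e
  exact (act_ray_eq_iff (hz := hz) (a := 0) (b := 0).1 e).1

variable (hz) in
/-- The stabilizers of the lines on an affine point form a Kantor family of the translation
group. -/
theorem isKantorFamily : IsKantorFamily ⊤ (member hz) (tangent hz) where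
  le := member_le_tangent
  le_total i := le_top
  exists_three := by
    obtain ⟨L, h1⟩ := Set.nonempty_of_two_lt_encard (T.isGQ.thick_point T.x)
    obtain ⟨M, h2, hML, -⟩ :=
      Set.exists_mem_ne_ne_of_two_lt_encard (T.isGQ.thick_point T.x) L L
    obtain ⟨N, h3, hNL, hNM⟩ :=
      Set.exists_mem_ne_ne_of_two_lt_encard (T.isGQ.thick_point T.x) L M
    exact ⟨⟨L, h1⟩, ⟨M, h2⟩, ⟨N, h3⟩, fun e => hML (congrArg Subtype.val e).symm,
      fun e => hNL (congrArg Subtype.val e).symm, fun e => hNM (congrArg Subtype.val e).symm⟩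
  exists_ne_zero i := by
    obtain ⟨q, hq, hqf, hqz⟩ := Set.exists_mem_ne_ne_of_two_lt_encard
      (T.isGQ.thick_line (ray hz i)) (foot hz i) z
    obtain ⟨a, ha, rfl⟩ := (eq_foot_or_eq_act hq).resolve_left hqf
    refine ⟨a, ha, ?_⟩
    rintro rfl
    exact hqz rfl
  triangle i j k hij hik hjk a ha b hb c hc e := by
    subst e
    by_contra ha0
    -- `z`, `a z`, `(a + b) z` would be a triangle
    have hzj : ¬ T.I z (T.actLine a (ray hz j)) := fun hzj => by
      have haj : a ∈ member hz j := by
        have := base_inc_act_ray (a := 0).1 hzj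
        rwa [zero_sub, neg_mem_iff] at this
      rcases T.isGQ.eq_or_eq _ _ _ _ (base_inc_ray i) (mem_member_iff.1 ha) (base_inc_ray j)
        (mem_member_iff.1 haj) with e | e
      · exact ha0 (eq_zero_of_actPoint hz e.symm)
      · exact hij (ray_injective e)
    refine hik (ray_injective (T.isGQ.proj_unique hzj (base_inc_ray i) (mem_member_iff.1 ha)
      ((inc_act a _ _).2 (base_inc_ray j)) (base_inc_ray k) (mem_member_iff.1 hc) ?_).2)
    rw [base_inc_act_ray, add_sub_cancel_left]
    exact hb
  disjoint i j hij a ha ha' := by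
    -- `foot i`, `z`, `a z` would be a triangle
    have h0 : ¬ T.I (foot hz i) (ray hz j) := fun h =>
      hij (act_foot_inc_act_ray (hz := hz) (a := 0) (b := 0).1 h).1
    refine eq_zero_of_actPoint hz (T.isGQ.proj_unique h0 (foot_inc_ray i) (base_inc_ray i)
      (base_inc_ray j) (?_ : T.I _ (T.actLine a (ray hz i))) ?_ (mem_member_iff.1 ha')).1.symm
    · rw [← mem_tangent.1 ha, inc_act]
      exact foot_inc_ray i
    · rw [inc_act]
      exact base_inc_ray i
  split i c _ hc := by
    -- project the point `c z` onto `ray i`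
    obtain ⟨⟨q, M⟩, h1, h2, h3⟩ := (T.isGQ.proj (T.actPoint c z) (ray hz i) fun h =>
      hc (member_le_tangent i (mem_member_iff.2 h))).exists
    obtain ⟨j, rfl⟩ := exists_eq_act_ray_of_inc (hz := hz) h1
    rcases eq_foot_or_eq_act h3 with rfl | ⟨a, ha, rfl⟩
    · obtain ⟨rfl, hmem⟩ := act_foot_inc_act_ray (a := 0).1 h2
      rw [zero_sub, neg_mem_iff] at hmem
      exact absurd hmem hc
    · have hb := base_inc_act_ray.1 h2
      refine ⟨j, ?_, a, ha, c - a, ?_, add_sub_cancel a c⟩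
      · rintro rfl
        have := (member hz j).sub_mem ha hb
        rw [sub_sub_cancel] at this
        exact hc (member_le_tangent j this)
      · rw [← neg_sub]
        exact (member hz j).neg_mem hb
  sum i j hij c _ := by
    -- project the point `c (foot i)` onto `ray j`
    have h0 : ¬ T.I (T.actPoint c (foot hz i)) (ray hz j) := fun h =>
      hij (act_foot_inc_act_ray (b := 0).1 h).1
    obtain ⟨⟨q, M⟩, h1, h2, h3⟩ := (T.isGQ.proj _ _ h0).exists
    rcases eq_foot_or_eq_act h3 with rfl | ⟨b, hb, rfl⟩
    · exfalso
      have h4 : ¬ T.I (T.actPoint c (foot hz i)) j.1 := fun h4 =>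
        (T.isGQ.eq_or_eq _ _ _ _ (act_foot_inc c i) i.2 h4 j.2).elim (act_foot_ne_x c i)
          fun e => hij (Subtype.ext e)
      exact x_ne_foot (hz := hz) j (T.isGQ.proj_unique h4 (act_foot_inc c i) i.2 j.2 h1 h2
        (foot_inc (hz := hz) j)).1
    · exact ⟨b, hb, (act_foot_eq_iff.1 (eq_act_foot h2 h1 (act_foot_inc c i)).1).2⟩

end Coordinates

end TGQ

/-! ### Coordinates and ideal containment -/

namespace IsKantorFamily

/-- The tangent groups of an extension of a Kantor family are generated by the old tangent groups
and the new members. -/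
theorem exists_sub_mem {G G' I : Type*} [AddCommGroup G] [AddCommGroup G']
    {S R : I → AddSubgroup G} {S' R' : I → AddSubgroup G'} (h : IsKantorFamily ⊤ S R)
    (h' : IsKantorFamily ⊤ S' R') {ι : G →+ G'} (hι : Function.Injective ι)
    (hS : ∀ i a, ι a ∈ S' i ↔ a ∈ S i) (hR : ∀ i a, ι a ∈ R' i ↔ a ∈ R i) {i : I} {c : G'}
    (hc : c ∈ R' i) : ∃ r ∈ R i, c - ι r ∈ S' i := by
  obtain ⟨j, hj⟩ := h.exists_ne i
  obtain ⟨d, hd, hd0⟩ := h.exists_ne_zero j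
  have hcd : c + ι d ∉ R' i := fun hmem =>
    h'.notMem_of_ne_zero hj.symm ((hS j d).2 hd) ((map_ne_zero_iff ι hι).2 hd0)
      (by simpa using (R' i).sub_mem hmem hc)
  obtain ⟨l, hl, u, hu, v, hv, e⟩ := h'.split i _ trivial hcd
  obtain ⟨b, hb, hdb⟩ := h.sum i l hl.symm d trivial
  have e' : v - ι b = (c - u) + ι (d - b) := by
    rw [map_sub, eq_sub_of_add_eq' e]
    abel
  have h0 : v - ι b = 0 := by
    refine h'.disjoint i l hl.symm _ ?_ ((S' l).sub_mem hv ((hS l b).2 hb))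
    rw [e']
    exact (R' i).add_mem ((R' i).sub_mem hc (h'.le i hu)) ((hR i _).2 hdb)
  refine ⟨b - d, ?_, ?_⟩
  · rw [← neg_sub]
    exact (R i).neg_mem hdb
  · have : c - ι (b - d) = u := by
      rw [h0] at e'
      rw [map_sub] at e' ⊢
      rw [← sub_eq_zero, e']
      abel
    rw [this]
    exact hu

/-- If there are only three members, then they have order two. -/
theorem eq_of_three {G I : Type*} [AddCommGroup G] {S R : I → AddSubgroup G}
    (h : IsKantorFamily ⊤ S R) {i j k : I} (hI : ∀ l, l = i ∨ l = j ∨ l = k) {m : I} {d a : G}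
    (hd : d ∈ S m) (hd0 : d ≠ 0) (ha : a ∈ S m) : a = 0 ∨ a = d := by
  obtain ⟨f, hf⟩ := h.exists_injective m
  have h1 : f ⟨d, hd⟩ ≠ f 0 := fun e => hd0 (congrArg Subtype.val (hf e))
  have h2 : f ⟨a, ha⟩ = f 0 → a = 0 := fun e => congrArg Subtype.val (hf e)
  have h3 : f ⟨a, ha⟩ = f ⟨d, hd⟩ → a = d := fun e => congrArg Subtype.val (hf e)
  have n1 := (f ⟨d, hd⟩).2
  have n2 := (f ⟨a, ha⟩).2
  have n3 := (f 0).2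
  simp only [ne_eq, Subtype.ext_iff] at h1 h2 h3
  have hm := hI m
  have t1 := hI (f ⟨d, hd⟩).1
  have t2 := hI (f ⟨a, ha⟩).1
  have t3 := hI (f 0).1
  grind

end IsKantorFamily

namespace KantorGeometry

variable {G G' I : Type*} [AddCommGroup G] [AddCommGroup G'] {S R : I → AddSubgroup G}
  {S' R' : I → AddSubgroup G'}

theorem mid_inc_aff (hSR : ∀ i, S i ≤ R i) {i j : I} {a b : G} :
    Inc (.mid i a : Point R) (.aff j b : Line S) ↔ i = j ∧ b - a ∈ R i := by
  rw [inc_line_aff hSR]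
  simp only [reduceCtorEq, and_false, exists_false, or_false]
  exact mid_eq_mid

theorem aff_inc_aff {j : I} {c b : G} :
    Inc (.aff c : Point R) (.aff j b : Line S) ↔ c - b ∈ S j :=
  QuotientAddGroup.mk_eq_mk_iff

/-- The map on points induced by a homomorphism of Kantor families. -/
def mapPoint (ι : G →+ G') (hR : ∀ i a, ι a ∈ R' i ↔ a ∈ R i) : Point R → Point R'
  | .apex => .apex
  | .mid i q => .mid i (QuotientAddGroup.map (R i) (R' i) ι (fun a ha => (hR i a).2 ha) q)
  | .aff a => .aff (ι a)

/-- The map on lines induced by a homomorphism of Kantor families. -/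
def mapLine (ι : G →+ G') (hS : ∀ i a, ι a ∈ S' i ↔ a ∈ S i) : Line S → Line S'
  | .inf i => .inf i
  | .aff i q => .aff i (QuotientAddGroup.map (S i) (S' i) ι (fun a ha => (hS i a).2 ha) q)

section Map

variable {ι : G →+ G'} (hS : ∀ i a, ι a ∈ S' i ↔ a ∈ S i) (hR : ∀ i a, ι a ∈ R' i ↔ a ∈ R i)

theorem mapPoint_mid (i : I) (a : G) : mapPoint ι hR (.mid i a) = .mid i (ι a) := rfl

theorem mapLine_aff (i : I) (a : G) : mapLine ι hS (.aff i a) = .aff i (ι a) := rfl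

theorem mapPoint_injective (hι : Function.Injective ι) : Function.Injective (mapPoint ι hR) := by
  intro p q e
  induction p using Point.cases_mk with
  | apex =>
    induction q using Point.cases_mk with
    | apex => rfl
    | mid j b => exact absurd e (by simp [mapPoint])
    | aff b => exact absurd e (by simp [mapPoint])
  | mid i a =>
    induction q using Point.cases_mk with
    | apex => exact absurd e (by simp [mapPoint])
    | mid j b =>
      rw [mapPoint_mid, mapPoint_mid, mid_eq_mid, ← map_sub, hR] at e
      exact mid_eq_mid.2 e
    | aff b => exact absurd e (by simp [mapPoint])
  | aff a =>
    induction q using Point.cases_mk with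
    | apex => exact absurd e (by simp [mapPoint])
    | mid j b => exact absurd e (by simp [mapPoint])
    | aff b => rw [hι (Point.aff.inj e)]

theorem mapLine_injective : Function.Injective (mapLine ι hS) := by
  intro L M e
  induction L using Line.cases_mk with
  | inf i =>
    induction M using Line.cases_mk with
    | inf j => rw [Line.inf.inj e]
    | aff j b => exact absurd e (by simp [mapLine])
  | aff i a =>
    induction M using Line.cases_mk with
    | inf j => exact absurd e (by simp [mapLine])
    | aff j b =>
      rw [mapLine_aff, mapLine_aff, aff_eq_aff, ← map_sub, hS] at e
      exact aff_eq_aff.2 e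

theorem inc_map_iff (h : IsKantorFamily ⊤ S R) (h' : IsKantorFamily ⊤ S' R') (p : Point R)
    (L : Line S) : Inc (mapPoint ι hR p) (mapLine ι hS L) ↔ Inc p L := by
  induction p using Point.cases_mk with
  | apex =>
    cases L
    · exact Iff.rfl
    · exact Iff.rfl
  | mid i a =>
    induction L using Line.cases_mk with
    | inf j => exact Iff.rfl
    | aff j b => rw [mapPoint_mid, mapLine_aff, mid_inc_aff h'.le, mid_inc_aff h.le, ← map_sub, hR]
  | aff c =>
    induction L using Line.cases_mk with
    | inf j => exact Iff.rfl
    | aff j b =>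
      rw [mapLine_aff, aff_inc_aff, ← hS, map_sub]
      exact aff_inc_aff

theorem exists_mapLine_eq (h : IsKantorFamily ⊤ S R) (h' : IsKantorFamily ⊤ S' R')
    (hι : Function.Injective ι) {p : Point R} {U : Line S'} (hU : Inc (mapPoint ι hR p) U) :
    ∃ L, mapLine ι hS L = U := by
  induction p using Point.cases_mk with
  | apex =>
    obtain ⟨i, rfl⟩ := apex_inc.1 hU
    exact ⟨.inf i, rfl⟩
  | mid i a =>
    rcases (mid_inc h'.le).1 hU with rfl | ⟨b, hb, rfl⟩
    · exact ⟨.inf i, rfl⟩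
    · obtain ⟨r, -, hrS⟩ := h.exists_sub_mem h' hι hS hR hb
      refine ⟨.aff i (a + r : G), ?_⟩
      rw [mapLine_aff, aff_eq_aff, map_add, ← sub_sub]
      exact ⟨rfl, hrS⟩
  | aff c =>
    obtain ⟨j, rfl⟩ := aff_inc.1 hU
    exact ⟨.aff j c, rfl⟩

theorem mapPoint_shift (a : G) (p : Point R) :
    mapPoint ι hR (shiftPoint a p) = shiftPoint (ι a) (mapPoint ι hR p) := by
  induction p using Point.cases_mk with
  | apex => rfl
  | mid i b => exact congrArg (fun c : G' => Point.mid i (c : G' ⧸ R' i)) (map_add ι a b)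
  | aff b => exact congrArg Point.aff (map_add ι a b)

theorem mapLine_shift (a : G) (L : Line S) :
    mapLine ι hS (shiftLine a L) = shiftLine (ι a) (mapLine ι hS L) := by
  induction L using Line.cases_mk with
  | inf i => rfl
  | aff i b => exact congrArg (fun c : G' => Line.aff i (c : G' ⧸ S' i)) (map_add ι a b)

end Map

end KantorGeometry

namespace TGQ

open KantorGeometry

variable {P B : Type*} {T : TGQ P B} {z : P} (hz : T.IsAffine z)

/-- The point with given coordinates. -/
noncomputable def ofPoint : Point (tangent hz) → P
  | .apex => T.x
  | .mid i q => T.actPoint q.out (foot hz i)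
  | .aff a => T.actPoint a z

/-- The line with given coordinates. -/
noncomputable def ofLine : Line (member hz) → B
  | .inf i => i.1
  | .aff i q => T.actLine q.out (ray hz i)

theorem ofPoint_mid (i : T.Direction) (a : Additive T.A) :
    ofPoint hz (.mid i a) = T.actPoint a (foot hz i) := by
  refine (act_foot_eq_iff (hz := hz)).2 ⟨rfl, ?_⟩
  rw [← QuotientAddGroup.mk_eq_mk_iff, QuotientAddGroup.out_eq']

theorem ofLine_aff (i : T.Direction) (a : Additive T.A) :
    ofLine hz (.aff i a) = T.actLine a (ray hz i) := by
  refine (act_ray_eq_iff (hz := hz)).2 ⟨rfl, ?_⟩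
  rw [← QuotientAddGroup.mk_eq_mk_iff, QuotientAddGroup.out_eq']

theorem ofPoint_aff (a : Additive T.A) : ofPoint hz (.aff a) = T.actPoint a z := rfl

theorem inc_of_iff (p : Point (tangent hz)) (L : Line (member hz)) :
    T.I (ofPoint hz p) (ofLine hz L) ↔ Inc p L := by
  induction p using Point.cases_mk with
  | apex =>
    induction L using Line.cases_mk with
    | inf i => exact iff_of_true i.2 trivial
    | aff i a =>
      rw [ofLine_aff]
      exact iff_of_false (not_x_inc_act_ray a i) id
  | mid i a =>
    induction L using Line.cases_mk with
    | inf j =>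
      rw [ofPoint_mid]
      refine ⟨fun h => ?_, fun h => ?_⟩
      · by_contra hij
        exact (T.isGQ.eq_or_eq _ _ _ _ (act_foot_inc a i) i.2 h j.2).elim (act_foot_ne_x a i)
          fun e => hij (Subtype.ext e)
      · obtain rfl : i = j := h
        exact act_foot_inc a i
    | aff j b =>
      rw [ofPoint_mid, ofLine_aff, act_foot_inc_act_ray, mid_inc_aff member_le_tangent,
        ← neg_mem_iff, neg_sub]
  | aff c =>
    induction L using Line.cases_mk with
    | inf j => exact iff_of_false (fun h => isAffine_act c hz ⟨j.1, j.2, h⟩) id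
    | aff j b => rw [ofPoint_aff, ofLine_aff, base_inc_act_ray, aff_inc_aff]

theorem ofPoint_bijective : Function.Bijective (ofPoint hz) := by
  constructor
  · have hax : ∀ a : Additive T.A, T.x ≠ T.actPoint a z := fun a e =>
      isAffine_act a hz (by
        rw [← e]
        obtain ⟨L, hL⟩ := Set.nonempty_of_two_lt_encard (T.isGQ.thick_point T.x)
        exact ⟨L, hL, hL⟩)
    have hma : ∀ (a b : Additive T.A) i, T.actPoint a (foot hz i) ≠ T.actPoint b z :=
      fun a b i e => isAffine_act b hz ⟨i.1, i.2, e ▸ act_foot_inc a i⟩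
    intro p q e
    induction p using Point.cases_mk with
    | apex =>
      induction q using Point.cases_mk with
      | apex => rfl
      | mid j b => exact absurd e.symm (by rw [ofPoint_mid]; exact act_foot_ne_x b j)
      | aff b => exact absurd e (hax b)
    | mid i a =>
      induction q using Point.cases_mk with
      | apex => exact absurd e (by rw [ofPoint_mid]; exact act_foot_ne_x a i)
      | mid j b =>
        rw [ofPoint_mid, ofPoint_mid, act_foot_eq_iff, ← neg_mem_iff, neg_sub] at e
        exact mid_eq_mid.2 e
      | aff b => exact absurd e (by rw [ofPoint_mid]; exact hma a b i)
    | aff a =>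
      induction q using Point.cases_mk with
      | apex => exact absurd e.symm (hax a)
      | mid j b => exact absurd e.symm (by rw [ofPoint_mid]; exact hma b a j)
      | aff b =>
        have := eq_zero_of_actPoint hz (actPoint_eq_iff.1 e)
        rw [sub_eq_zero.1 this]
  · intro p
    by_cases hp : T.IsAffine p
    · obtain ⟨a, rfl⟩ := exists_actPoint_eq hz hp
      exact ⟨.aff a, rfl⟩
    · by_cases hpx : p = T.x
      · exact ⟨.apex, hpx.symm⟩
      · obtain ⟨L, hL, hpL⟩ := not_not.1 hp
        obtain ⟨a, rfl⟩ := exists_eq_act_foot (hz := hz) ⟨L, hL⟩ hpL hpx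
        exact ⟨.mid ⟨L, hL⟩ a, ofPoint_mid hz _ a⟩

theorem ofLine_bijective : Function.Bijective (ofLine hz) := by
  constructor
  · intro L M e
    induction L using Line.cases_mk with
    | inf i =>
      induction M using Line.cases_mk with
      | inf j => rw [show i = j from Subtype.ext e]
      | aff j b =>
        rw [ofLine_aff] at e
        have hi : T.I T.x (ofLine hz (.inf i)) := i.2
        rw [e] at hi
        exact absurd hi (not_x_inc_act_ray b j)
    | aff i a =>
      induction M using Line.cases_mk with
      | inf j =>
        rw [ofLine_aff] at e
        have hj : T.I T.x (ofLine hz (.inf j)) := j.2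
        rw [← e] at hj
        exact absurd hj (not_x_inc_act_ray a i)
      | aff j b =>
        rw [ofLine_aff, ofLine_aff, act_ray_eq_iff, ← neg_mem_iff, neg_sub] at e
        exact aff_eq_aff.2 e
  · intro M
    by_cases hM : T.I T.x M
    · exact ⟨.inf ⟨M, hM⟩, rfl⟩
    · obtain ⟨a, i, rfl⟩ := exists_eq_act_ray (hz := hz) hM
      exact ⟨.aff i a, ofLine_aff hz i a⟩

theorem ofPoint_shift (a : Additive T.A) (p : Point (tangent hz)) :
    ofPoint hz (shiftPoint a p) = T.actPoint a (ofPoint hz p) := by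
  induction p using Point.cases_mk with
  | apex => exact (actPoint_x a).symm
  | mid i b =>
    rw [ofPoint_mid, ← actPoint_add]
    exact ofPoint_mid hz i (a + b)
  | aff b => exact actPoint_add a b z

theorem ofLine_shift (a : Additive T.A) (L : Line (member hz)) :
    ofLine hz (shiftLine a L) = T.actLine a (ofLine hz L) := by
  induction L using Line.cases_mk with
  | inf i => exact (actLine_of_inc a i.2).symm
  | aff i b =>
    rw [ofLine_aff, ← actLine_add]
    exact ofLine_aff hz i (a + b)

/-- A translation generalized quadrangle is ideally contained in the quadrangle of every Kantor
family that extends its own one. -/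
theorem ideallyContainedIn {G' : Type*} [AddCommGroup G'] {S' R' : T.Direction → AddSubgroup G'}
    (h' : IsKantorFamily ⊤ S' R') {ι : Additive T.A →+ G'} (hι : Function.Injective ι)
    (hS : ∀ i a, ι a ∈ S' i ↔ a ∈ member hz i) (hR : ∀ i a, ι a ∈ R' i ↔ a ∈ tangent hz i) :
    T.IdeallyContainedIn (toTGQ h') := by
  have h := isKantorFamily hz
  let f := Equiv.ofBijective _ (ofPoint_bijective hz)
  let g := Equiv.ofBijective _ (ofLine_bijective hz)
  refine ⟨fun p => mapPoint ι hR (f.symm p), fun L => mapLine ι hS (g.symm L),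
    (mapPoint_injective hR hι).comp f.symm.injective,
    (mapLine_injective hS).comp g.symm.injective, fun p L => ?_, fun p U hU => ?_, ?_,
    fun a ha => ?_⟩
  · obtain ⟨p, rfl⟩ := f.surjective p
    obtain ⟨L, rfl⟩ := g.surjective L
    simp only [Equiv.symm_apply_apply]
    exact (inc_map_iff hS hR h h' p L).trans (inc_of_iff hz p L).symm
  · obtain ⟨L, hL⟩ := exists_mapLine_eq hS hR h h' hι hU
    exact ⟨g L, by simp only [Equiv.symm_apply_apply, hL]⟩
  · rw [show T.x = f .apex from rfl]
    simp only [Equiv.symm_apply_apply]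
    rfl
  · let b : Additive T.A := Additive.ofMul ⟨a, ha⟩
    refine ⟨_, (translationEquiv h' (ι b)).toMul.2, fun p => ?_, fun L => ?_⟩
    · obtain ⟨p, rfl⟩ := f.surjective p
      rw [show a.1 (f p) = f (shiftPoint b p) from (ofPoint_shift hz b p).symm]
      simp only [Equiv.symm_apply_apply]
      exact mapPoint_shift hR b p
    · obtain ⟨L, rfl⟩ := g.surjective L
      rw [show a.2 (g L) = g (shiftLine b L) from (ofLine_shift hz b L).symm]
      simp only [Equiv.symm_apply_apply]
      exact mapLine_shift hS b L

end TGQ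

/-! ### Quadrangles with three lines on a point, and the representation theorem -/

theorem Set.encard_eq_three_of_two_lt {α : Type*} {s : Set α} (hs : 2 < s.encard) {a b c : α}
    (h : ∀ x ∈ s, x = a ∨ x = b ∨ x = c) : s.encard = (2 : ℕ) + 1 := by
  refine le_antisymm ?_ (Order.add_one_le_of_lt hs)
  calc s.encard ≤ ({a, b, c} : Set α).encard := Set.encard_le_encard h
    _ ≤ ({b, c} : Set α).encard + 1 := Set.encard_insert_le _ _
    _ ≤ ({c} : Set α).encard + 1 + 1 := by gcongr; exact Set.encard_insert_le _ _
    _ = (2 : ℕ) + 1 := by rw [Set.encard_singleton]; norm_num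

namespace TGQ

variable {P : Type u} {B : Type v} {T : TGQ P B}

/-- A translation generalized quadrangle with only three lines on the translation point has order
`(2, 2)`. -/
theorem hasOrder_two_two {i j k : T.Direction} (hij : i ≠ j) (hik : i ≠ k) (hjk : j ≠ k)
    (hI : ∀ l, l = i ∨ l = j ∨ l = k) : T.HasOrder 2 2 := by
  obtain ⟨z, hz⟩ := T.exists_isAffine
  have h := isKantorFamily hz
  constructor
  · intro L
    by_cases hL : T.I T.x L
    · obtain ⟨m, hm⟩ := h.exists_ne ⟨L, hL⟩
      obtain ⟨d, hd, hd0⟩ := h.exists_ne_zero m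
      refine Set.encard_eq_three_of_two_lt (T.isGQ.thick_line L) (a := T.x)
        (b := foot hz ⟨L, hL⟩) (c := T.actPoint d (foot hz ⟨L, hL⟩)) fun q hq => ?_
      by_cases hqx : q = T.x
      · exact Or.inl hqx
      · right
        obtain ⟨a, rfl⟩ := exists_eq_act_foot (hz := hz) ⟨L, hL⟩ hq hqx
        obtain ⟨b, hb, hab⟩ := h.sum _ m hm.symm a trivial
        have e := (act_foot_eq_iff (hz := hz)).2 ⟨rfl, hab⟩
        rw [e]
        rcases h.eq_of_three hI hd hd0 hb with rfl | rfl
        · exact Or.inl rfl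
        · exact Or.inr rfl
    · obtain ⟨a, m, rfl⟩ := exists_eq_act_ray (hz := hz) hL
      obtain ⟨d, hd, hd0⟩ := h.exists_ne_zero m
      refine Set.encard_eq_three_of_two_lt (T.isGQ.thick_line _)
        (a := T.actPoint a (foot hz m)) (b := T.actPoint a z)
        (c := T.actPoint (a + d) z) fun q hq => ?_
      have hq' : T.I (T.actPoint (-a) q) (ray hz m) := by
        rw [← inc_act a, ← actPoint_add, add_neg_cancel]
        exact hq
      have hqa : ∀ w, T.actPoint (-a) q = w → q = T.actPoint a w := by
        rintro w rfl
        rw [← actPoint_add, add_neg_cancel, actPoint_zero]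
      rcases eq_foot_or_eq_act hq' with e | ⟨b, hb, e⟩
      · exact Or.inl (hqa _ e)
      · rw [hqa _ e]
        rcases h.eq_of_three hI hd hd0 hb with rfl | rfl
        · exact Or.inr (Or.inl rfl)
        · exact Or.inr (Or.inr rfl)
  · intro p
    by_cases hp : T.IsAffine p
    · obtain ⟨c, rfl⟩ := exists_actPoint_eq hz hp
      refine Set.encard_eq_three_of_two_lt (T.isGQ.thick_point _) (a := T.actLine c (ray hz i))
        (b := T.actLine c (ray hz j)) (c := T.actLine c (ray hz k)) fun M hM => ?_
      obtain ⟨l, rfl⟩ := exists_eq_act_ray_of_inc (hz := hz) hM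
      rcases hI l with rfl | rfl | rfl
      · exact Or.inl rfl
      · exact Or.inr (Or.inl rfl)
      · exact Or.inr (Or.inr rfl)
    · by_cases hpx : p = T.x
      · subst hpx
        refine Set.encard_eq_three_of_two_lt (T.isGQ.thick_point _) (a := i.1) (b := j.1)
          (c := k.1) fun M hM => ?_
        simpa only [Subtype.ext_iff] using hI ⟨M, hM⟩
      · obtain ⟨L, hL, hpL⟩ := not_not.1 hp
        obtain ⟨a, rfl⟩ := exists_eq_act_foot (hz := hz) ⟨L, hL⟩ hpL hpx
        set m : T.Direction := ⟨L, hL⟩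
        obtain ⟨n, hn⟩ := h.exists_ne m
        obtain ⟨o, hom, hon⟩ := h.exists_ne_ne m n
        obtain ⟨d, hd, hd0⟩ := h.exists_ne_zero n
        obtain ⟨f, hf, hf0⟩ := h.exists_ne_zero o
        refine Set.encard_eq_three_of_two_lt (T.isGQ.thick_point _) (a := L)
          (b := T.actLine a (ray hz m)) (c := T.actLine (a + (f - d)) (ray hz m)) fun M hM => ?_
        by_cases hxM : T.I T.x M
        · left
          exact ((T.isGQ.eq_or_eq _ _ _ _ hL hpL hxM hM).resolve_left
            (act_foot_ne_x a m).symm).symm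
        · right
          obtain ⟨c, m', rfl⟩ := exists_eq_act_ray (hz := hz) hxM
          obtain ⟨rfl, hR⟩ := act_foot_inc_act_ray.1 hM
          have hca : c - a ∈ tangent hz m := by
            rw [← neg_sub]
            exact (tangent hz m).neg_mem hR
          have hcd : c - a + d ∉ tangent hz m := fun hmem =>
            h.notMem_of_ne_zero hn.symm hd hd0 (by
              simpa using (tangent hz m).sub_mem hmem hca)
          obtain ⟨l, hl, u, hu, w, hw, e⟩ := h.split m _ trivial hcd
          have hlno : l = n ∨ l = o := by
            -- `m`, `n` and `o` exhaust the three indices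
            have h1 := hI l
            have h2 := hI m
            have h3 := hI n
            have h4 := hI o
            grind
          rcases hlno with rfl | rfl
          · left
            have hwd : w - d = 0 := by
              refine h.disjoint m l hn.symm _ ?_ ((member hz l).sub_mem hw hd)
              have : w - d = c - a - u := by
                rw [eq_sub_of_add_eq' e]
                abel
              rw [this]
              exact (tangent hz m).sub_mem hca (h.le m hu)
            refine (act_ray_eq_iff (hz := hz)).2 ⟨rfl, ?_⟩
            rw [sub_eq_zero.1 hwd] at e
            rwa [← add_right_cancel e]
          · right
            have hwf : w = f := by
              refine (h.eq_of_three hI hf hf0 hw).resolve_left fun hw0 => hcd ?_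
              rw [← e, hw0, add_zero]
              exact h.le m hu
            refine (act_ray_eq_iff (hz := hz)).2 ⟨rfl, ?_⟩
            have : c - (a + (f - d)) = u := by
              rw [eq_sub_of_add_eq e, hwf]
              abel
            rwa [this]

/-- Apart from the quadrangle of order `(2, 2)` there are at least four lines on the translation
point. -/
theorem exists_two_more_directions (hT : ¬ T.HasOrder 2 2) (i j : T.Direction) :
    ∃ k l, i ≠ k ∧ i ≠ l ∧ j ≠ k ∧ j ≠ l ∧ k ≠ l := by
  obtain ⟨z, hz⟩ := T.exists_isAffine
  have h := isKantorFamily hz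
  have main : ∀ i j : T.Direction, i ≠ j → ∃ k l, i ≠ k ∧ i ≠ l ∧ j ≠ k ∧ j ≠ l ∧ k ≠ l := by
    intro i j hij
    obtain ⟨k, hki, hkj⟩ := h.exists_ne_ne i j
    by_contra! hc
    refine hT (hasOrder_two_two hij hki.symm hkj.symm fun l => ?_)
    by_contra! hl
    exact hl.2.2 (hc k l hki.symm hl.1.symm hkj.symm hl.2.1.symm).symm
  by_cases hij : i = j
  · subst hij
    obtain ⟨k, hk⟩ := h.exists_ne i
    obtain ⟨m, n, h1, h2, -, -, h3⟩ := main i k hk.symm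
    exact ⟨m, n, h1, h2, h1, h2, h3⟩
  · exact main i j hij

end TGQ

theorem theorem1p2 {P : Type u} {B : Type v} (T : TGQ P B) (hT : ¬ T.HasOrder 2 2) :
    ∃ (P' B' : Type (max u v)) (T' : TGQ P' B'),
      T.IdeallyContainedIn T' ∧ T'.IsLinear ∧
      ∃ (K V : Type (max u v)) (_ : DivisionRing K) (_ : AddCommGroup V) (_ : Module K V),
        Nonempty (T'.ProjectiveRepresentation K V) := by
  obtain ⟨z, hz⟩ := T.exists_isAffine
  have h4 := TGQ.exists_two_more_directions hT
  obtain ⟨G', _, S', R', ι, h', hι, hS, hR, hbij⟩ :=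
    (TGQ.isKantorFamily hz).exists_linear_extension h4
  have hlin := KantorGeometry.isLinear h' hbij
  have := hlin.1
  let _ : DivisionRing (KantorGeometry.toTGQ h').kernel :=
    DivisionRing.ofIsUnitOrEqZero fun ξ => or_iff_not_imp_right.2 (hlin.2 ξ)
  exact ⟨_, _, KantorGeometry.toTGQ h', TGQ.ideallyContainedIn hz h' hι hS hR, hlin,
    (KantorGeometry.toTGQ h').kernel, Additive (KantorGeometry.toTGQ h').A, inferInstance,
    inferInstance, inferInstance,
    KantorGeometry.nonempty_projectiveRepresentation h' h4 (RingEquiv.refl _) (AddEquiv.refl _)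
      fun _ _ => rfl⟩
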